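/- Fix $K\ge 1$, group probabilities $p^*_1,\dots,p^*_K\ge 0$ with $\sum_k p^*_k=1$, a number $q^*\in[0,1]$, and $\gamma,\alpha\in(0,1]$; put $\theta^*=\frac{\gamma}{\gamma+\alpha(1-\gamma)}\in(0,1]$. The $K$-groups preferential attachment (KPA) process $(G_t)_{t\ge0}$ is the following random sequence of multigraphs, in which every node carries a label in $\{1,\dots,K\}$, its group. The graph $G_0$ is deterministic, with $n_0\ge1$ nodes, each of degree one (by convention, whatever its $e_0$ edges are), of which exactly $p^*_kn_0$ belong to group $k$. At each time $t\ge1$, independently of the past, a vertex-step is made with probability $q^*$ and an edge-step with probability $1-q^*$. In a vertex-step a new node $w$ arrives, which belongs to group $k$ with probability $p^*_k$; in an edge-step $w$ is an old node, chosen with probability proportional to its degree in $G_{t-1}$. Then nodes of $G_{t-1}$ are recommended to $w$ until one of them, $u$, is accepted, and the edge $(w,u)$ is added; the degrees of $w$ and $u$ go up by one each (by two if $w=u$; a new node $w$ has degree one). The first recommendation is chosen among all nodes of $G_{t-1}$ with probability proportional to the degree; every later one is chosen, with probability $\alpha$, among the nodes of the group of $w$ and, with probability $1-\alpha$, among the nodes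 of the other groups, in each case proportionally to the degree. A recommended node of the group of $w$ is always accepted; any other is accepted with probability $\gamma$ and rejected with probability $1-\gamma$. For the snapshot $G_T$ let $V_T$ and $E_T$ be the numbers of nodes and of edges, $V_T^k$ the number of nodes of group $k$, $D_T^k$ the sum of the degrees of the nodes of group $k$, $E_T^{k,1}$ the number of edges with both nodes in group $k$, and $E_T^{k,0}$ the number of edges $(w,u)$ with $w$ in group $k$ and $u$ in another group (so that every edge between different groups is counted once in $\sum_kE_T^{k,0}$). Put $a_k=D_T^k/(2E_T)$ and, for $\theta\in(0,1]$, $$L_T(\theta\mid G_T)=\sum_{k=1}^K E_T^{k,1}\log\bigl(a_k\,(a_k+(1-\theta)(1-a_k))\bigr)+\sum_{k=1}^K E_T^{k,0}\log\bigl(a_k\,\theta\,(1-a_k)\bigr).$$ Let $\tilde p_k=V_T^k/V_T$, $\tilde q=V_T/E_T$, and let $\tilde\theta=\tilde\theta_T$ be a maximiser of $L_T(\cdot\mid G_T)$ over $(0,1]$. Then, almost surely, as $T\to\infty$, $\tilde p_k\to p^*_k$ for every $k$ and $\tilde q\to q^*$. If moreover $p^*_k<1$ for every $k$ (that is, at least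 two groups have positive probability), then almost surely the maximiser of $L_T(\cdot\mid G_T)$ over $(0,1]$ exists and is unique for all sufficiently large $T$, and $\tilde\theta_T\to\theta^*$. -/

import Mathlib

open MeasureTheory Filter Topology

/-- A finite multigraph whose nodes `0, …, n - 1` carry group labels in `Fin K` and degrees.
An edge is an ordered pair `(w, u)`: `w` is the node that asks for a connection and `u` is the node
it gets connected to.  Loops and repeated edges are allowed.  The degrees are part of the data,
because the nodes of the initial graph have degree one by convention. -/
structure KGraph (K : ℕ) where
  n : ℕ
  grp : Fin n → Fin K
  deg : Fin n → ℕ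
  edges : Multiset (Fin n × Fin n)

noncomputable section

namespace KGraph

variable {K : ℕ}

/-- Sum of all degrees. -/
def totalDeg (G : KGraph K) : ℕ := ∑ i, G.deg i

/-- `D^k`: sum of the degrees of the nodes of group `k`. -/
def groupDeg (G : KGraph K) (k : Fin K) : ℕ := ∑ i with G.grp i = k, G.deg i

/-- Sum of the degrees of the nodes outside group `k`. -/
def otherDeg (G : KGraph K) (k : Fin K) : ℕ := ∑ i with G.grp i ≠ k, G.deg i

/-- `V^k`: number of nodes of group `k`. -/
def groupSize (G : KGraph K) (k : Fin K) : ℕ := (Finset.univ.filter fun i => G.grp i = k).card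

/-- `E`: number of edges. -/
def numEdges (G : KGraph K) : ℕ := G.edges.card

/-- `E^{k,1}`: number of edges with both nodes in group `k`. -/
def innerEdges (G : KGraph K) (k : Fin K) : ℕ :=
  G.edges.countP fun e => G.grp e.1 = k ∧ G.grp e.2 = k

/-- `E^{k,0}`: number of edges `(w, u)` from a node `w` of group `k` to a node `u` of another
group. -/
def outerEdges (G : KGraph K) (k : Fin K) : ℕ :=
  G.edges.countP fun e => G.grp e.1 = k ∧ G.grp e.2 ≠ k

/-- A new node (with index `n`) of group `k` arrives and is connected to the old node `u`. -/
def addVertex (G : KGraph K) (k : Fin K) (u : Fin G.n) : KGraph K where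
  n := G.n + 1
  grp := Fin.snoc (α := fun _ => Fin K) G.grp k
  deg := Fin.snoc (α := fun _ => ℕ) (fun i => G.deg i + if i = u then 1 else 0) 1
  edges := (Fin.last G.n, u.castSucc) ::ₘ G.edges.map (Prod.map Fin.castSucc Fin.castSucc)

/-- A new edge `(w, u)` between old nodes is added (a loop raises the degree by two). -/
def addEdge (G : KGraph K) (w u : Fin G.n) : KGraph K where
  n := G.n
  grp := G.grp
  deg := fun i => G.deg i + (if i = w then 1 else 0) + (if i = u then 1 else 0)
  edges := (w, u) ::ₘ G.edges

/-- Probability that the `r`-th recommendation (`r = 0, 1, 2, …`) to a node of group `k` is `u`: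
the first one is proportional to the degree among all nodes; every later one is taken within group
`k` with probability `α`, and outside group `k` with probability `1 - α`, in both cases
proportionally to the degree. -/
def recommendProb (G : KGraph K) (α : ℝ) (k : Fin K) (r : ℕ) (u : Fin G.n) : ℝ :=
  if r = 0 then (G.deg u : ℝ) / G.totalDeg
  else if G.grp u = k then α * ((G.deg u : ℝ) / G.groupDeg k)
  else (1 - α) * ((G.deg u : ℝ) / G.otherDeg k)

/-- Probability that a node of group `k` accepts the recommended node `u`. -/
def acceptProb (G : KGraph K) (γ : ℝ) (k : Fin K) (u : Fin G.n) : ℝ :=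
  if G.grp u = k then 1 else γ

/-- Probability that a node of group `k` rejects the `r`-th recommendation, once it is made. -/
def rejectProb (G : KGraph K) (γ α : ℝ) (k : Fin K) (r : ℕ) : ℝ :=
  ∑ u, G.recommendProb α k r u * (1 - G.acceptProb γ k u)

/-- Probability that a node of group `k` is in the end connected to `u`, when recommendations are
made until one is accepted: for some `r`, the recommendations `0, …, r - 1` are rejected, and the
`r`-th one is `u` and is accepted. -/
def connectProb (G : KGraph K) (γ α : ℝ) (k : Fin K) (u : Fin G.n) : ℝ :=
  ∑' r : ℕ, (∏ s ∈ Finset.range r, G.rejectProb γ α k s) *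
    (G.recommendProb α k r u * G.acceptProb γ k u)

/-- The snapshot pseudo-log-likelihood of `θ`. -/
def snapshotLik (G : KGraph K) (θ : ℝ) : ℝ :=
  (∑ k, (G.innerEdges k : ℝ) *
    Real.log ((G.groupDeg k : ℝ) / (2 * G.numEdges) *
      ((G.groupDeg k : ℝ) / (2 * G.numEdges) +
        (1 - θ) * (1 - (G.groupDeg k : ℝ) / (2 * G.numEdges))))) +
  ∑ k, (G.outerEdges k : ℝ) *
    Real.log ((G.groupDeg k : ℝ) / (2 * G.numEdges) * θ *
      (1 - (G.groupDeg k : ℝ) / (2 * G.numEdges)))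

/-- `θ` is a maximiser over `(0, 1]` of the snapshot pseudo-log-likelihood. -/
def IsSnapshotMaximizer (G : KGraph K) (θ : ℝ) : Prop :=
  θ ∈ Set.Ioc (0 : ℝ) 1 ∧ ∀ θ' ∈ Set.Ioc (0 : ℝ) 1, G.snapshotLik θ' ≤ G.snapshotLik θ

end KGraph

/-- `G 0, G 1, …` is a K-groups preferential attachment process started at `G₀`: a Markov chain of
graphs which at every time, independently of the past, makes a vertex-step with probability `q` and
an edge-step with probability `1 - q`.  In a vertex-step the new node belongs to group `k` with
probability `p k`; in an edge-step the asking node `w` is an old one, chosen proportionally to the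
degree.  In both cases the other node `u` is found by recommendation and acceptance, all
probabilities referring to the graph before the step. -/
structure IsKPA {Ω : Type*} [MeasurableSpace Ω] (P : Measure Ω) {K : ℕ} (p : Fin K → ℝ)
    (q γ α : ℝ) (G₀ : KGraph K) (G : ℕ → Ω → KGraph K) : Prop where
  measurable : ∀ t g, MeasurableSet {ω | G t ω = g}
  init : ∀ᵐ ω ∂P, G 0 ω = G₀
  vertex_step : ∀ (t : ℕ) (h : ℕ → KGraph K) (k : Fin K) (u : Fin (h t).n),
    P.real {ω | (∀ i ≤ t, G i ω = h i) ∧ G (t + 1) ω = (h t).addVertex k u} =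
      P.real {ω | ∀ i ≤ t, G i ω = h i} * (q * p k * (h t).connectProb γ α k u)
  edge_step : ∀ (t : ℕ) (h : ℕ → KGraph K) (w u : Fin (h t).n),
    P.real {ω | (∀ i ≤ t, G i ω = h i) ∧ G (t + 1) ω = (h t).addEdge w u} =
      P.real {ω | ∀ i ≤ t, G i ω = h i} *
        ((1 - q) * (((h t).deg w : ℝ) / (h t).totalDeg) *
          (h t).connectProb γ α ((h t).grp w) u)

end

noncomputable section

namespace KGraph

variable {K : ℕ}

/-! ### Effect of a step on the counts -/

/-! Summing the series over the recommendations shows that a node of group j is connected to group l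
with probability θ a_l + (1 - θ) 1{l = j}, where θ = θ* and a_l is the degree share of group l
(`connectProb_eq`, `sum_connectProb`). So γ and α enter only through θ*, the mean increment of each
count is an explicit function of the shares (`drift`), and a count minus its accumulated drift is a
martingale with bounded increments.

With S the total degree, a_k - p_k is multiplied at each step by 1 - q(2 - θ)/S and perturbed by
noise whose series converges (`ae_share_recursion`). If q > 0, the sum of 1/S diverges and a_k →
p_k. If q = 0, the share is a martingale, whose limit may be random; the supermartingale log(S/D) +
2/D, with D the degree of the group, shows that the limit is positive (`ae_exists_tendsto_share`).
Once the shares converge, so do the counts divided by time (`ae_exists_limits`): with π_k = q p_k +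
(1 - q) a_k, the limits are π_k (1 - θ*(1 - a_k)) for inner edges and π_k θ*(1 - a_k) for outer
edges.

For large times the likelihood is strictly concave in θ (`snapshotLik_lt`), and θ times its
derivative, divided by time, tends to (θ* - θ) ∑ π_k (1 - a_k)/(1 - θ(1 - a_k)). The sum is positive
when two groups have positive probability, so the sign changes exactly at θ*, whatever the limit
shares are. Hence the maximisers tend to θ* even when the shares do not tend to p. -/

theorem groupDeg_eq_sum (G : KGraph K) (k : Fin K) :
    G.groupDeg k = ∑ i, if G.grp i = k then G.deg i else 0 := by
  rw [groupDeg, Finset.sum_filter]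

theorem groupDeg_add_otherDeg (G : KGraph K) (k : Fin K) :
    G.groupDeg k + G.otherDeg k = G.totalDeg :=
  Finset.sum_filter_add_sum_filter_not _ _ _

theorem sum_groupDeg (G : KGraph K) : ∑ k, G.groupDeg k = G.totalDeg :=
  Finset.sum_fiberwise _ _ _

theorem groupDeg_addVertex (G : KGraph K) (j : Fin K) (u : Fin G.n) (k : Fin K) :
    (G.addVertex j u).groupDeg k =
      G.groupDeg k + ((if j = k then 1 else 0) + if G.grp u = k then 1 else 0) := by
  rw [groupDeg_eq_sum, groupDeg_eq_sum]
  change (∑ i : Fin (G.n + 1), if (Fin.snoc (α := fun _ => Fin K) G.grp j : _ → Fin K) i = k then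
    (Fin.snoc (α := fun _ => ℕ) (fun i => G.deg i + if i = u then 1 else 0) 1 : _ → ℕ) i else 0) = _
  rw [Fin.sum_univ_castSucc]
  simp only [Fin.snoc_castSucc, Fin.snoc_last]
  have h : ∀ i : Fin G.n, (if G.grp i = k then G.deg i + (if i = u then 1 else 0) else 0) =
      (if G.grp i = k then G.deg i else 0) + if i = u then (if G.grp u = k then 1 else 0) else 0 := by
    intro i
    by_cases hi : i = u
    · subst hi; split_ifs <;> simp
    · simp [hi]
  simp only [h, Finset.sum_add_distrib, Finset.sum_ite_eq', Finset.mem_univ, if_true]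
  ring

theorem groupDeg_addEdge (G : KGraph K) (w u : Fin G.n) (k : Fin K) :
    (G.addEdge w u).groupDeg k =
      G.groupDeg k + ((if G.grp w = k then 1 else 0) + if G.grp u = k then 1 else 0) := by
  rw [groupDeg_eq_sum, groupDeg_eq_sum]
  change (∑ i : Fin G.n, if G.grp i = k then
    G.deg i + (if i = w then 1 else 0) + (if i = u then 1 else 0) else 0) = _
  have h : ∀ i : Fin G.n, (if G.grp i = k then
      G.deg i + (if i = w then 1 else 0) + (if i = u then 1 else 0) else 0) =
      (if G.grp i = k then G.deg i else 0) + (if i = w then (if G.grp w = k then 1 else 0) else 0)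
        + if i = u then (if G.grp u = k then 1 else 0) else 0 := by
    intro i
    split_ifs <;> simp_all
  simp only [h, Finset.sum_add_distrib, Finset.sum_ite_eq', Finset.mem_univ, if_true]
  ring

theorem totalDeg_addVertex (G : KGraph K) (j : Fin K) (u : Fin G.n) :
    (G.addVertex j u).totalDeg = G.totalDeg + 2 := by
  simp [← sum_groupDeg, groupDeg_addVertex, Finset.sum_add_distrib]

theorem totalDeg_addEdge (G : KGraph K) (w u : Fin G.n) :
    (G.addEdge w u).totalDeg = G.totalDeg + 2 := by
  simp [← sum_groupDeg, groupDeg_addEdge, Finset.sum_add_distrib]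

theorem numEdges_addVertex (G : KGraph K) (j : Fin K) (u : Fin G.n) :
    (G.addVertex j u).numEdges = G.numEdges + 1 := by
  simp [numEdges, addVertex]

theorem numEdges_addEdge (G : KGraph K) (w u : Fin G.n) :
    (G.addEdge w u).numEdges = G.numEdges + 1 := by
  simp [numEdges, addEdge]

theorem groupSize_eq_sum (G : KGraph K) (k : Fin K) :
    G.groupSize k = ∑ i, if G.grp i = k then 1 else 0 := by
  rw [groupSize, Finset.card_filter]

theorem groupSize_addVertex (G : KGraph K) (j : Fin K) (u : Fin G.n) (k : Fin K) :
    (G.addVertex j u).groupSize k = G.groupSize k + if j = k then 1 else 0 := by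
  rw [groupSize_eq_sum, groupSize_eq_sum]
  change (∑ i : Fin (G.n + 1), if (Fin.snoc (α := fun _ => Fin K) G.grp j : _ → Fin K) i = k then 1
    else 0) = _
  rw [Fin.sum_univ_castSucc]
  simp only [Fin.snoc_castSucc, Fin.snoc_last]

theorem groupSize_addEdge (G : KGraph K) (w u : Fin G.n) (k : Fin K) :
    (G.addEdge w u).groupSize k = G.groupSize k := rfl

theorem innerEdges_addVertex (G : KGraph K) (j : Fin K) (u : Fin G.n) (k : Fin K) :
    (G.addVertex j u).innerEdges k =
      G.innerEdges k + if j = k ∧ G.grp u = k then 1 else 0 := by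
  change Multiset.countP (fun e : Fin (G.n + 1) × Fin (G.n + 1) =>
    (Fin.snoc (α := fun _ => Fin K) G.grp j : _ → Fin K) e.1 = k ∧
    (Fin.snoc (α := fun _ => Fin K) G.grp j : _ → Fin K) e.2 = k)
    ((Fin.last G.n, u.castSucc) ::ₘ G.edges.map (Prod.map Fin.castSucc Fin.castSucc)) = _
  rw [Multiset.countP_cons, Multiset.countP_map, innerEdges, Multiset.countP_eq_card_filter]
  simp only [Prod.map_fst, Prod.map_snd, Fin.snoc_castSucc, Fin.snoc_last]

theorem innerEdges_addEdge (G : KGraph K) (w u : Fin G.n) (k : Fin K) :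
    (G.addEdge w u).innerEdges k =
      G.innerEdges k + if G.grp w = k ∧ G.grp u = k then 1 else 0 := by
  exact Multiset.countP_cons _ _ _

theorem outerEdges_addVertex (G : KGraph K) (j : Fin K) (u : Fin G.n) (k : Fin K) :
    (G.addVertex j u).outerEdges k =
      G.outerEdges k + if j = k ∧ G.grp u ≠ k then 1 else 0 := by
  change Multiset.countP (fun e : Fin (G.n + 1) × Fin (G.n + 1) =>
    (Fin.snoc (α := fun _ => Fin K) G.grp j : _ → Fin K) e.1 = k ∧
    (Fin.snoc (α := fun _ => Fin K) G.grp j : _ → Fin K) e.2 ≠ k)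
    ((Fin.last G.n, u.castSucc) ::ₘ G.edges.map (Prod.map Fin.castSucc Fin.castSucc)) = _
  rw [Multiset.countP_cons, Multiset.countP_map, outerEdges, Multiset.countP_eq_card_filter]
  simp only [Prod.map_fst, Prod.map_snd, Fin.snoc_castSucc, Fin.snoc_last]

theorem outerEdges_addEdge (G : KGraph K) (w u : Fin G.n) (k : Fin K) :
    (G.addEdge w u).outerEdges k =
      G.outerEdges k + if G.grp w = k ∧ G.grp u ≠ k then 1 else 0 := by
  exact Multiset.countP_cons _ _ _

theorem addVertex_injective {G : KGraph K} {j j' : Fin K} {u u' : Fin G.n}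
    (h : G.addVertex j u = G.addVertex j' u') : j = j' ∧ u = u' := by
  simp only [addVertex, KGraph.mk.injEq, heq_eq_eq, true_and] at h
  obtain ⟨h1, h2, -⟩ := h
  refine ⟨by simpa using congrFun h1 (Fin.last _), ?_⟩
  have := congrFun h2 u.castSucc
  by_contra hne
  simp [hne] at this

/-- The degrees determine only the unordered pair; the ordered one comes from cancelling in the edge
multiset. -/
theorem addEdge_injective {G : KGraph K} {w w' u u' : Fin G.n}
    (h : G.addEdge w u = G.addEdge w' u') : w = w' ∧ u = u' := by
  simp only [addEdge, KGraph.mk.injEq, heq_eq_eq, true_and] at h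
  obtain ⟨-, h⟩ := h
  simpa using h

theorem addVertex_ne_addEdge (G : KGraph K) (j : Fin K) (v w u : Fin G.n) :
    G.addVertex j v ≠ G.addEdge w u := by
  intro h
  have := congrArg KGraph.n h
  simp [addVertex, addEdge] at this

/-! ### Moves -/

/-- The possible steps from `G`: arrival of a node of a given group connected to a given node, or
an edge between two given nodes. -/
abbrev Move (G : KGraph K) : Type := (Fin K × Fin G.n) ⊕ (Fin G.n × Fin G.n)

/-- The graph after a move. -/
def move (G : KGraph K) : G.Move → KGraph K
  | .inl m => G.addVertex m.1 m.2
  | .inr m => G.addEdge m.1 m.2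

theorem move_injective (G : KGraph K) : Function.Injective G.move := by
  rintro (⟨j, u⟩ | ⟨w, u⟩) (⟨j', u'⟩ | ⟨w', u'⟩) h
  · obtain ⟨rfl, rfl⟩ := addVertex_injective h; rfl
  · exact absurd h (addVertex_ne_addEdge _ _ _ _ _)
  · exact absurd h.symm (addVertex_ne_addEdge _ _ _ _ _)
  · obtain ⟨rfl, rfl⟩ := addEdge_injective h; rfl

/-- Probability of a move in the KPA process. -/
def moveProb (G : KGraph K) (p : Fin K → ℝ) (q γ α : ℝ) : G.Move → ℝ
  | .inl m => q * p m.1 * G.connectProb γ α m.1 m.2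
  | .inr m => (1 - q) * ((G.deg m.1 : ℝ) / G.totalDeg) * G.connectProb γ α (G.grp m.1) m.2

/-- The mean of `f` after one step of the KPA process from `G`. -/
def stepMean (G : KGraph K) (p : Fin K → ℝ) (q γ α : ℝ) (f : KGraph K → ℝ) : ℝ :=
  ∑ m, G.moveProb p q γ α m * f (G.move m)

/-- The value of `φ` at a move: `φ` depends on the kind of the move (`true` for the arrival of a
node), the group of the asking node and the group of the node it is connected to. -/
def moveInc (G : KGraph K) (φ : Bool → Fin K → Fin K → ℝ) : G.Move → ℝ
  | .inl m => φ true m.1 (G.grp m.2)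
  | .inr m => φ false (G.grp m.1) (G.grp m.2)

/-- `f` grows by `φ` at every move. -/
def HasIncrement (f : KGraph K → ℝ) (φ : Bool → Fin K → Fin K → ℝ) : Prop :=
  ∀ G m, f (move G m) = f G + moveInc G φ m

theorem hasIncrement_groupDeg (k : Fin K) : HasIncrement (fun G => (G.groupDeg k : ℝ))
    fun _ j l => (if j = k then 1 else 0) + if l = k then 1 else 0 := by
  rintro G (⟨j, u⟩ | ⟨w, u⟩)
  · simp [move, moveInc, groupDeg_addVertex]
  · simp [move, moveInc, groupDeg_addEdge]

theorem hasIncrement_innerEdges (k : Fin K) : HasIncrement (fun G => (G.innerEdges k : ℝ))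
    fun _ j l => (if j = k then 1 else 0) * if l = k then 1 else 0 := by
  rintro G (⟨j, u⟩ | ⟨w, u⟩)
  · by_cases h : G.grp u = k <;> simp [move, moveInc, innerEdges_addVertex, h]
  · by_cases h : G.grp u = k <;> simp [move, moveInc, innerEdges_addEdge, h]

theorem hasIncrement_outerEdges (k : Fin K) : HasIncrement (fun G => (G.outerEdges k : ℝ))
    fun _ j l => (if j = k then 1 else 0) * (1 - if l = k then 1 else 0) := by
  rintro G (⟨j, u⟩ | ⟨w, u⟩)
  · by_cases h : G.grp u = k <;> simp [move, moveInc, outerEdges_addVertex, h]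
  · by_cases h : G.grp u = k <;> simp [move, moveInc, outerEdges_addEdge, h]

theorem hasIncrement_groupSize (k : Fin K) : HasIncrement (fun G => (G.groupSize k : ℝ))
    fun v j _ => if v then (if j = k then 1 else 0) else 0 := by
  rintro G (⟨j, u⟩ | ⟨w, u⟩)
  · simp [move, moveInc, groupSize_addVertex]
  · simp [move, moveInc, groupSize_addEdge]

theorem hasIncrement_n : HasIncrement (fun G : KGraph K => (G.n : ℝ))
    fun v _ _ => if v then 1 else 0 := by
  rintro G (⟨j, u⟩ | ⟨w, u⟩)
  · simp [move, moveInc, addVertex]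
  · simp [move, moveInc, addEdge]

theorem totalDeg_move (G : KGraph K) (m : G.Move) : (G.move m).totalDeg = G.totalDeg + 2 := by
  rcases m with m | m
  · exact totalDeg_addVertex _ _ _
  · exact totalDeg_addEdge _ _ _

theorem numEdges_move (G : KGraph K) (m : G.Move) : (G.move m).numEdges = G.numEdges + 1 := by
  rcases m with m | m
  · exact numEdges_addVertex _ _ _
  · exact numEdges_addEdge _ _ _

/-! ### Connection probabilities -/

/-- `a_k`: the share of group `k` in the sum of the degrees. -/
def share (G : KGraph K) (k : Fin K) : ℝ := (G.groupDeg k : ℝ) / G.totalDeg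

theorem rejectProb_zero (G : KGraph K) (γ α : ℝ) (k : Fin K) :
    G.rejectProb γ α k 0 = (1 - γ) * (G.otherDeg k / G.totalDeg) := by
  have h : ∀ u, G.recommendProb α k 0 u * (1 - G.acceptProb γ k u) =
      (1 - γ) * ((if G.grp u ≠ k then (G.deg u : ℝ) else 0) / G.totalDeg) := by
    intro u
    by_cases hu : G.grp u = k <;> simp [recommendProb, acceptProb, hu]
    ring
  simp only [rejectProb, h, ← Finset.mul_sum, ← Finset.sum_div, otherDeg, ← Finset.sum_filter,
    Nat.cast_sum]

/-- The last quotient is 1, except when the other groups have no degree: then 0 / 0 = 0, in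
accordance with recommendation probabilities that all vanish outside group `k`. -/
theorem rejectProb_succ (G : KGraph K) (γ α : ℝ) (k : Fin K) (r : ℕ) :
    G.rejectProb γ α k (r + 1) = (1 - α) * (1 - γ) * (G.otherDeg k / G.otherDeg k) := by
  have h : ∀ u, G.recommendProb α k (r + 1) u * (1 - G.acceptProb γ k u) =
      (1 - α) * (1 - γ) * ((if G.grp u ≠ k then (G.deg u : ℝ) else 0) / G.otherDeg k) := by
    intro u
    by_cases hu : G.grp u = k <;> simp [recommendProb, acceptProb, hu]
    ring
  simp only [rejectProb, h, ← Finset.mul_sum, ← Finset.sum_div, ← Finset.sum_filter]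
  congr 2
  simp [otherDeg]

variable {γ α : ℝ}

theorem connect_same_aux (d : ℝ) {D O T : ℝ} (hT : T ≠ 0) (hD : D ≠ 0)
    (h : γ + α * (1 - γ) ≠ 0) :
    d / T * 1 + (1 - γ) * (O / T) * (α * (d / D) * 1) * (γ + α * (1 - γ))⁻¹ =
      d / T * (1 + (1 - γ / (γ + α * (1 - γ))) * (O / D)) := by
  have h1 : 1 - γ / (γ + α * (1 - γ)) = α * (1 - γ) * (γ + α * (1 - γ))⁻¹ := by
    rw [eq_comm, ← div_eq_mul_inv, div_eq_iff h, sub_mul, div_mul_cancel₀ _ h]; ring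
  rw [h1]
  generalize (γ + α * (1 - γ))⁻¹ = x
  field_simp

theorem connect_other_aux (d : ℝ) {O T : ℝ} (hT : T ≠ 0) (hO : O ≠ 0)
    (h : γ + α * (1 - γ) ≠ 0) :
    d / T * γ + (1 - γ) * (O / T) * ((1 - α) * (d / O) * γ) * (γ + α * (1 - γ))⁻¹ =
      d / T * (γ / (γ + α * (1 - γ))) := by
  have h1 : (1 - γ) * (1 - α) * (γ + α * (1 - γ))⁻¹ = (γ + α * (1 - γ))⁻¹ - 1 := by
    rw [← div_eq_mul_inv, div_eq_iff h, sub_mul (_⁻¹), inv_mul_cancel₀ h]; ring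
  have h2 : (1 - γ) * (O / T) * ((1 - α) * (d / O) * γ) * (γ + α * (1 - γ))⁻¹ =
      d / T * γ * ((1 - γ) * (1 - α) * (γ + α * (1 - γ))⁻¹) := by
    generalize (γ + α * (1 - γ))⁻¹ = x
    field_simp
  rw [h2, h1]
  ring

/-- From the second recommendation on, the rejection probability is a constant σ, so the series is
its first term plus a geometric tail. In general 1 - σ = γ + α(1 - γ), the denominator of θ*. If the
other groups have no degree, the first rejection has probability 0 and the tail disappears. -/
theorem connectProb_eq (G : KGraph K) (hγ : γ ∈ Set.Ioc (0 : ℝ) 1) (hα : α ∈ Set.Ioc (0 : ℝ) 1)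
    (k : Fin K) (hk : 0 < G.groupDeg k) (u : Fin G.n) :
    G.connectProb γ α k u = (G.deg u : ℝ) / G.totalDeg *
      if G.grp u = k then 1 + (1 - γ / (γ + α * (1 - γ))) * (G.otherDeg k / G.groupDeg k)
      else γ / (γ + α * (1 - γ)) := by
  obtain ⟨hγ0, hγ1⟩ := hγ
  obtain ⟨hα0, hα1⟩ := hα
  have htot : (0 : ℝ) < G.totalDeg := by
    have := G.groupDeg_add_otherDeg k
    exact_mod_cast (by omega : 0 < G.totalDeg)
  have hk' : (0 : ℝ) < G.groupDeg k := by exact_mod_cast hk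
  have hden : 0 < γ + α * (1 - γ) := by nlinarith
  set σ : ℝ := (1 - α) * (1 - γ) * (G.otherDeg k / G.otherDeg k) with hσ
  have hσ0 : 0 ≤ σ := mul_nonneg (mul_nonneg (by linarith) (by linarith)) (by positivity)
  have hσ1 : σ < 1 := by
    have h1 : ((G.otherDeg k : ℝ) / G.otherDeg k) ≤ 1 := div_self_le_one _
    have h2 : σ ≤ (1 - α) * (1 - γ) :=
      mul_le_of_le_one_right (mul_nonneg (by linarith) (by linarith)) h1
    nlinarith
  set B : ℝ := G.recommendProb α k 1 u * G.acceptProb γ k u with hB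
  have hsum : HasSum (fun r : ℕ => (∏ s ∈ Finset.range (r + 1), G.rejectProb γ α k s) *
      (G.recommendProb α k (r + 1) u * G.acceptProb γ k u))
      (G.rejectProb γ α k 0 * B * (1 - σ)⁻¹) := by
    refine ((hasSum_geometric_of_lt_one hσ0 hσ1).mul_left (G.rejectProb γ α k 0 * B)).congr_fun
      fun r => ?_
    rw [Finset.prod_range_succ']
    simp only [rejectProb_succ, Finset.prod_const, Finset.card_range]
    have : G.recommendProb α k (r + 1) u = G.recommendProb α k 1 u := by simp [recommendProb]
    rw [this]
    ring
  have hmain : G.connectProb γ α k u = G.recommendProb α k 0 u * G.acceptProb γ k u +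
      G.rejectProb γ α k 0 * B * (1 - σ)⁻¹ := by
    rw [connectProb, hsum.zero_add.tsum_eq]
    simp
  rw [hmain, rejectProb_zero]
  by_cases ho : G.otherDeg k = 0
  · have hdeg : G.grp u ≠ k → G.deg u = 0 := by
      intro hu
      have := Finset.sum_eq_zero_iff.1 (ho : (∑ i with G.grp i ≠ k, G.deg i) = 0) u (by simp [hu])
      exact this
    by_cases hu : G.grp u = k
    · simp [recommendProb, acceptProb, hu, ho]
    · simp [recommendProb, acceptProb, hu, ho, hdeg hu]
  · have ho' : (G.otherDeg k : ℝ) ≠ 0 := by exact_mod_cast ho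
    have h1 : 1 - σ = γ + α * (1 - γ) := by rw [hσ, div_self ho']; ring
    rw [h1]
    by_cases hu : G.grp u = k
    · simp only [hB, recommendProb, acceptProb, hu, if_true, one_ne_zero, if_false]
      exact connect_same_aux _ htot.ne' hk'.ne' hden.ne'
    · simp only [hB, recommendProb, acceptProb, hu, one_ne_zero, if_false]
      exact connect_other_aux _ htot.ne' ho' hden.ne'

/-- Probability that a node of group `j` gets connected to group `l`, for degree shares `a`. -/
def linkProb (θ : ℝ) (a : Fin K → ℝ) (j l : Fin K) : ℝ := θ * a l + (1 - θ) * if l = j then 1 else 0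

/-- Within the own group the factor collapses: a_j (1 + (1 - θ)(1 - a_j)/a_j) = θ a_j + (1 - θ). -/
theorem sum_connectProb (G : KGraph K) (hγ : γ ∈ Set.Ioc (0 : ℝ) 1) (hα : α ∈ Set.Ioc (0 : ℝ) 1)
    (j : Fin K) (hj : 0 < G.groupDeg j) (f : Fin K → ℝ) :
    ∑ u, G.connectProb γ α j u * f (G.grp u) =
      ∑ l, linkProb (γ / (γ + α * (1 - γ))) G.share j l * f l := by
  rw [← Finset.sum_fiberwise _ G.grp]
  refine Finset.sum_congr rfl fun l _ => ?_
  have htot : (0 : ℝ) < G.totalDeg := by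
    have := G.groupDeg_add_otherDeg j
    exact_mod_cast (by omega : 0 < G.totalDeg)
  have hj' : (0 : ℝ) < G.groupDeg j := by exact_mod_cast hj
  have h : ∀ u ∈ Finset.univ.filter (fun u => G.grp u = l), G.connectProb γ α j u * f (G.grp u) =
      G.deg u * (1 / G.totalDeg * (if l = j then
        1 + (1 - γ / (γ + α * (1 - γ))) * (G.otherDeg j / G.groupDeg j)
        else γ / (γ + α * (1 - γ))) * f l) := by
    intro u hu
    have hu' : G.grp u = l := by simpa using hu
    rw [connectProb_eq G hγ hα j hj, hu']
    ring
  rw [Finset.sum_congr rfl h, ← Finset.sum_mul]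
  have h2 : (∑ u with G.grp u = l, (G.deg u : ℝ)) = G.groupDeg l := by simp [groupDeg]
  rw [h2, linkProb, share]
  split_ifs with hl
  · subst hl
    have h3 : (G.otherDeg l : ℝ) = G.totalDeg - G.groupDeg l := by
      rw [← G.groupDeg_add_otherDeg l]; push_cast; ring
    rw [h3]
    generalize γ / (γ + α * (1 - γ)) = θ
    field_simp
    ring
  · ring

/-! ### Mean increments of the counts -/

/-- The mean increment for degree shares `a`. -/
def drift (p : Fin K → ℝ) (q θ : ℝ) (a : Fin K → ℝ) (φ : Bool → Fin K → Fin K → ℝ) : ℝ :=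
  ∑ j, ∑ l, linkProb θ a j l * (q * p j * φ true j l + (1 - q) * a j * φ false j l)

/-- The groups of positive probability are exactly the ones which occur, and they have positive
degree. -/
structure Regular (p : Fin K → ℝ) (G : KGraph K) : Prop where
  grp_pos : ∀ i, 0 < p (G.grp i)
  groupDeg_pos : ∀ k, 0 < p k → 0 < G.groupDeg k

/-- Degrees never decrease and an edge-step brings no new label, so only the label of an arriving
node has to be checked. -/
theorem Regular.move {p : Fin K → ℝ} {G : KGraph K} (h : Regular p G) {m : G.Move}
    (hm : ∀ x, m = .inl x → 0 < p x.1) : Regular p (G.move m) := by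
  rcases m with ⟨j, u⟩ | ⟨w, u⟩
  · refine ⟨fun i => ?_, fun k hk => ?_⟩
    · change 0 < p ((Fin.snoc (α := fun _ => Fin K) G.grp j : Fin (G.n + 1) → Fin K) i)
      refine Fin.lastCases ?_ (fun i => ?_) i
      · simpa using hm _ rfl
      · simpa using h.grp_pos i
    · simp only [KGraph.move, groupDeg_addVertex]
      have := h.groupDeg_pos k hk
      omega
  · refine ⟨h.grp_pos, fun k hk => ?_⟩
    simp only [KGraph.move, groupDeg_addEdge]
    have := h.groupDeg_pos k hk
    omega

variable {p : Fin K → ℝ} {q : ℝ}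

theorem Regular.totalDeg_pos (hp1 : ∑ k, p k = 1) {G : KGraph K}
    (h : Regular p G) : 0 < G.totalDeg := by
  obtain ⟨k, -, hk⟩ : ∃ k ∈ Finset.univ, 0 < p k := by
    by_contra! hc
    have := Finset.sum_nonpos hc
    linarith
  have := h.groupDeg_pos k hk
  have := G.groupDeg_add_otherDeg k
  omega

theorem sum_share {G : KGraph K} (h : 0 < G.totalDeg) : ∑ k, G.share k = 1 := by
  simp only [share, ← Finset.sum_div]
  rw [← Nat.cast_sum, sum_groupDeg]
  exact div_self (by exact_mod_cast h.ne')

theorem share_nonneg (G : KGraph K) (k : Fin K) : 0 ≤ G.share k := by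
  unfold share; positivity

theorem Regular.share_eq_zero {G : KGraph K} (h : Regular p G) {k : Fin K} (hk : ¬ 0 < p k) :
    G.share k = 0 := by
  have : ∀ i, G.grp i ≠ k := fun i hi => hk (hi ▸ h.grp_pos i)
  simp [share, groupDeg, this]

theorem sum_moveProb_mul_moveInc (hγ : γ ∈ Set.Ioc (0 : ℝ) 1) (hα : α ∈ Set.Ioc (0 : ℝ) 1)
    (hp : ∀ k, 0 ≤ p k) {G : KGraph K} (h : Regular p G) (φ : Bool → Fin K → Fin K → ℝ) :
    ∑ m, G.moveProb p q γ α m * G.moveInc φ m =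
      drift p q (γ / (γ + α * (1 - γ))) G.share φ := by
  set θ := γ / (γ + α * (1 - γ)) with hθ
  rw [Fintype.sum_sum_type, Fintype.sum_prod_type, Fintype.sum_prod_type]
  have h1 : ∀ j, ∑ u, G.moveProb p q γ α (.inl (j, u)) * G.moveInc φ (.inl (j, u)) =
      ∑ l, linkProb θ G.share j l * (q * p j * φ true j l) := by
    intro j
    -- A group of probability 0 may have no degree, and then `sum_connectProb` is not available; but
    -- the factor `p j` kills the term.
    rcases (hp j).lt_or_eq with hj | hj
    · rw [← sum_connectProb G hγ hα j (h.groupDeg_pos j hj) fun l => q * p j * φ true j l]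
      refine Finset.sum_congr rfl fun u _ => ?_
      simp only [moveProb, moveInc]
      ring
    · simp [moveProb, ← hj]
  have h2 : ∑ w, ∑ u, G.moveProb p q γ α (.inr (w, u)) * G.moveInc φ (.inr (w, u)) =
      ∑ j, ∑ l, linkProb θ G.share j l * ((1 - q) * G.share j * φ false j l) := by
    rw [← Finset.sum_fiberwise _ G.grp]
    refine Finset.sum_congr rfl fun j _ => ?_
    have h3 : ∀ w ∈ Finset.univ.filter (fun w => G.grp w = j),
        ∑ u, G.moveProb p q γ α (.inr (w, u)) * G.moveInc φ (.inr (w, u)) =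
        G.deg w * (1 / G.totalDeg * (1 - q) * ∑ l, linkProb θ G.share j l * φ false j l) := by
      intro w hw
      have hw' : G.grp w = j := by simpa using hw
      rw [← sum_connectProb G hγ hα j (h.groupDeg_pos j (hw' ▸ h.grp_pos w)) fun l => φ false j l]
      rw [Finset.mul_sum, Finset.mul_sum]
      refine Finset.sum_congr rfl fun u _ => ?_
      simp only [moveProb, moveInc, hw']
      ring
    rw [Finset.sum_congr rfl h3, ← Finset.sum_mul]
    have h4 : (∑ u with G.grp u = j, (G.deg u : ℝ)) = G.groupDeg j := by simp [groupDeg]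
    rw [h4, Finset.mul_sum, Finset.mul_sum]
    refine Finset.sum_congr rfl fun l _ => ?_
    simp only [share]
    ring
  simp only [h1, h2]
  simp only [drift, mul_add, Finset.sum_add_distrib]

theorem connectProb_nonneg (hγ : γ ∈ Set.Ioc (0 : ℝ) 1) (hα : α ∈ Set.Ioc (0 : ℝ) 1)
    {G : KGraph K} {k : Fin K} (hk : 0 < G.groupDeg k) (u : Fin G.n) :
    0 ≤ G.connectProb γ α k u := by
  rw [connectProb_eq G hγ hα k hk]
  obtain ⟨hγ0, hγ1⟩ := hγ
  obtain ⟨hα0, hα1⟩ := hα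
  have h0 : 0 ≤ α * (1 - γ) := mul_nonneg hα0.le (by linarith)
  have h1 : γ / (γ + α * (1 - γ)) ≤ 1 := div_le_one_of_le₀ (by linarith) (by linarith)
  have h2 : 0 ≤ 1 - γ / (γ + α * (1 - γ)) := by linarith
  refine mul_nonneg (by positivity) ?_
  split_ifs <;> positivity

theorem moveProb_nonneg (hγ : γ ∈ Set.Ioc (0 : ℝ) 1) (hα : α ∈ Set.Ioc (0 : ℝ) 1)
    (hp : ∀ k, 0 ≤ p k) (hq : q ∈ Set.Icc (0 : ℝ) 1) {G : KGraph K} (h : Regular p G)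
    (m : G.Move) : 0 ≤ G.moveProb p q γ α m := by
  have hq0 := hq.1
  have hq1 : 0 ≤ 1 - q := by linarith [hq.2]
  rcases m with ⟨j, u⟩ | ⟨w, u⟩
  · simp only [moveProb]
    rcases (hp j).lt_or_eq with hj | hj
    · have := connectProb_nonneg hγ hα (h.groupDeg_pos j hj) u
      positivity
    · simp [← hj]
  · simp only [moveProb]
    have := connectProb_nonneg hγ hα (h.groupDeg_pos _ (h.grp_pos w)) u
    positivity

theorem sum_linkProb (θ : ℝ) {a : Fin K → ℝ} (ha : ∑ k, a k = 1) (j : Fin K) :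
    ∑ l, linkProb θ a j l = 1 := by
  simp [linkProb, Finset.sum_add_distrib, ← Finset.mul_sum, ha]

/-- If the increment does not depend on the group of the node found. -/
theorem drift_of_left (θ : ℝ) {a : Fin K → ℝ} (ha : ∑ k, a k = 1) (φ : Bool → Fin K → ℝ) :
    drift p q θ a (fun v j _ => φ v j) = ∑ j, (q * p j * φ true j + (1 - q) * a j * φ false j) := by
  simp only [drift, ← Finset.sum_mul, sum_linkProb θ ha, one_mul]

theorem sum_moveProb (hγ : γ ∈ Set.Ioc (0 : ℝ) 1) (hα : α ∈ Set.Ioc (0 : ℝ) 1)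
    (hp : ∀ k, 0 ≤ p k) (hp1 : ∑ k, p k = 1) {G : KGraph K} (h : Regular p G) :
    ∑ m, G.moveProb p q γ α m = 1 := by
  have h1 := sum_moveProb_mul_moveInc (q := q) hγ hα hp h fun _ _ _ => 1
  have h2 : ∀ m, G.moveInc (fun _ _ _ => 1) m = 1 := by rintro (m | m) <;> rfl
  have ha := sum_share (h.totalDeg_pos hp1)
  simp only [h2, mul_one] at h1
  rw [h1, drift_of_left _ ha fun _ _ => 1]
  simp [Finset.sum_add_distrib, ← Finset.mul_sum, ha, hp1]

theorem stepMean_of_hasIncrement (hγ : γ ∈ Set.Ioc (0 : ℝ) 1) (hα : α ∈ Set.Ioc (0 : ℝ) 1)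
    (hp : ∀ k, 0 ≤ p k) (hp1 : ∑ k, p k = 1) {G : KGraph K} (h : Regular p G)
    {f : KGraph K → ℝ} {φ : Bool → Fin K → Fin K → ℝ} (hf : HasIncrement f φ) :
    G.stepMean p q γ α f = f G + drift p q (γ / (γ + α * (1 - γ))) G.share φ := by
  rw [stepMean, ← sum_moveProb_mul_moveInc hγ hα hp h φ]
  simp only [hf G, mul_add, Finset.sum_add_distrib, ← Finset.sum_mul,
    sum_moveProb hγ hα hp hp1 h, one_mul]

/-- The asking end is in group k with probability x = q p_k + (1 - q) a_k, the found end with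
probability θ a_k + (1 - θ) x. The excess over 2 a_k, which would keep the share fixed in mean,
pulls the share towards p_k if θ ≤ 1 and q > 0. -/
theorem drift_groupDeg (θ : ℝ) {a : Fin K → ℝ} (ha : ∑ k, a k = 1) (hp1 : ∑ k, p k = 1)
    (k : Fin K) :
    drift p q θ a (fun _ j l => (if j = k then 1 else 0) + if l = k then 1 else 0) =
      2 * a k + q * (2 - θ) * (p k - a k) := by
  have h1 : drift p q θ a (fun _ j l => (if j = k then 1 else 0) + if l = k then 1 else 0) =
      drift p q θ a (fun _ j _ => if j = k then 1 else 0) +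
      drift p q θ a (fun _ _ l => if l = k then 1 else 0) := by
    simp only [drift, mul_add, Finset.sum_add_distrib]
    ring
  have h2 : drift p q θ a (fun _ _ l => if l = k then 1 else 0) =
      ∑ j, (θ * a k * (q * p j) + θ * a k * ((1 - q) * a j) +
        if k = j then (1 - θ) * (q * p j + (1 - q) * a j) else 0) := by
    simp only [drift]
    refine Finset.sum_congr rfl fun j _ => ?_
    rw [Finset.sum_eq_single k (by intro b _ hb; simp [hb]) (by simp)]
    by_cases hj : k = j
    · subst hj; simp [linkProb]; ring
    · simp [linkProb, hj]; ring
  rw [h1, h2, drift_of_left θ ha fun _ j => if j = k then 1 else 0]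
  simp only [Finset.sum_add_distrib, ← Finset.mul_sum, ha, hp1, Finset.sum_ite_eq, mul_ite, mul_one,
    mul_zero, Finset.sum_ite_eq', Finset.mem_univ, if_true]
  ring

theorem drift_innerEdges (θ : ℝ) (a : Fin K → ℝ) (k : Fin K) :
    drift p q θ a (fun _ j l => (if j = k then 1 else 0) * if l = k then 1 else 0) =
      (q * p k + (1 - q) * a k) * (1 - θ * (1 - a k)) := by
  simp only [drift]
  rw [Finset.sum_eq_single k (by intro b _ hb; simp [hb]) (by simp),
    Finset.sum_eq_single k (by intro b _ hb; simp [hb]) (by simp)]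
  simp only [linkProb, if_true]
  ring

theorem drift_outerEdges (θ : ℝ) {a : Fin K → ℝ} (ha : ∑ k, a k = 1) (k : Fin K) :
    drift p q θ a (fun _ j l => (if j = k then 1 else 0) * (1 - if l = k then 1 else 0)) =
      (q * p k + (1 - q) * a k) * (θ * (1 - a k)) := by
  have h : drift p q θ a (fun _ j l => (if j = k then 1 else 0) * (1 - if l = k then 1 else 0)) =
      drift p q θ a (fun _ j _ => if j = k then 1 else 0) -
      drift p q θ a (fun _ j l => (if j = k then 1 else 0) * if l = k then 1 else 0) := by
    simp only [drift, mul_sub, mul_one, mul_add, Finset.sum_add_distrib, Finset.sum_sub_distrib]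
    ring
  rw [h, drift_innerEdges, drift_of_left θ ha fun _ j => if j = k then 1 else 0]
  simp [Finset.sum_add_distrib]
  ring

theorem drift_groupSize (θ : ℝ) {a : Fin K → ℝ} (ha : ∑ k, a k = 1) (k : Fin K) :
    drift p q θ a (fun v j _ => if v then (if j = k then 1 else 0) else 0) = q * p k := by
  rw [drift_of_left θ ha fun v j => if v then (if j = k then 1 else 0) else 0]
  simp

theorem drift_n (θ : ℝ) {a : Fin K → ℝ} (ha : ∑ k, a k = 1) (hp1 : ∑ k, p k = 1) :
    drift p q θ a (fun v _ _ => if v then 1 else 0) = q := by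
  rw [drift_of_left θ ha fun v _ => if v then 1 else 0]
  simp [← Finset.mul_sum, hp1]

/-- Makes the set of histories up to a given time countable, so that conditioning on the past
reduces to conditioning on single histories. -/
instance : Countable (KGraph K) := by
  have : Function.Injective (fun G : KGraph K =>
      (⟨G.n, G.grp, G.deg, G.edges⟩ : Σ n, (Fin n → Fin K) × (Fin n → ℕ) ×
        Multiset (Fin n × Fin n))) := by
    rintro ⟨n, a, b, c⟩ ⟨n', a', b', c'⟩ h
    simp only [Sigma.mk.injEq] at h
    obtain ⟨rfl, h⟩ := h
    simp only [heq_eq_eq, Prod.mk.injEq] at h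
    obtain ⟨rfl, rfl, rfl⟩ := h
    rfl
  exact this.countable

end KGraph


/-! ### Random series with bounded martingale differences -/

section Noise

variable {Ω : Type*} [mΩ : MeasurableSpace Ω] {P : Measure Ω} [IsProbabilityMeasure P]
  {ℱ : Filtration ℕ mΩ}

omit [IsProbabilityMeasure P] in
theorem eLpNorm_one_le_of_integral_abs_le {X : Ω → ℝ} (hX : Integrable X P) {R : ℝ}
    (h : ∫ ω, |X ω| ∂P ≤ R) : eLpNorm X 1 P ≤ (R.toNNReal : ENNReal) := by
  rw [eLpNorm_one_eq_lintegral_enorm, ← ofReal_integral_norm_eq_lintegral_enorm hX]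
  exact ENNReal.ofReal_le_ofReal h

theorem integrable_of_ae_abs_le {X : Ω → ℝ} (hX : AEStronglyMeasurable X P) {C : ℝ}
    (h : ∀ᵐ ω ∂P, |X ω| ≤ C) : Integrable X P :=
  Integrable.of_bound hX C h

/-- The partial sums form a martingale with orthogonal increments, so their second moments are at
most C² ∑ r². Being bounded in L², hence in L¹, the martingale converges almost surely. -/
theorem ae_exists_tendsto_sum_mul_of_martingale_difference {ξ : ℕ → Ω → ℝ} {C : ℝ}
    (hadp : ∀ t, StronglyMeasurable[ℱ (t + 1)] (ξ t))
    (hbd : ∀ t, ∀ᵐ ω ∂P, |ξ t ω| ≤ C) (hce : ∀ t, P[ξ t | ℱ t] =ᵐ[P] 0)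
    {r : ℕ → ℝ} (hr : Summable fun t => r t ^ 2) :
    ∀ᵐ ω ∂P, ∃ l, Tendsto (fun n => ∑ s ∈ Finset.range n, r s * ξ s ω) atTop (𝓝 l) := by
  have hξm : ∀ t, AEStronglyMeasurable (ξ t) P := fun t =>
    ((hadp t).mono (ℱ.le _)).aestronglyMeasurable
  have hξi : ∀ t, Integrable (ξ t) P := fun t => integrable_of_ae_abs_le (hξm t) (hbd t)
  set N : ℕ → Ω → ℝ := fun n ω => ∑ s ∈ Finset.range n, r s * ξ s ω with hN
  have hNs : ∀ n ω, N (n + 1) ω = N n ω + r n * ξ n ω := fun n ω => Finset.sum_range_succ _ _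
  have hNadp : ∀ n, StronglyMeasurable[ℱ n] (N n) := by
    intro n
    refine Finset.stronglyMeasurable_fun_sum _ fun s hs => ?_
    exact ((hadp s).mono (ℱ.mono (Finset.mem_range.1 hs))).const_mul _
  have hNm : ∀ n, AEStronglyMeasurable (N n) P := fun n =>
    ((hNadp n).mono (ℱ.le _)).aestronglyMeasurable
  have hNbd : ∀ n, ∀ᵐ ω ∂P, |N n ω| ≤ ∑ s ∈ Finset.range n, |r s| * C := by
    intro n
    filter_upwards [ae_all_iff.2 hbd] with ω hω
    refine (Finset.abs_sum_le_sum_abs _ _).trans (Finset.sum_le_sum fun s _ => ?_)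
    rw [abs_mul]
    exact mul_le_mul_of_nonneg_left (hω s) (abs_nonneg _)
  have hNi : ∀ n, Integrable (N n) P := fun n => integrable_of_ae_abs_le (hNm n) (hNbd n)
  have hmart : Martingale N ℱ P := by
    refine martingale_of_condExp_sub_eq_zero_nat hNadp hNi fun i => ?_
    have h1 : N (i + 1) - N i = r i • ξ i := by
      ext ω; simp [hNs]
    rw [h1]
    refine (condExp_smul (r i) (ξ i) (ℱ i)).trans ?_
    filter_upwards [hce i] with ω hω
    simp [hω]
  have hNξ : ∀ n, Integrable (N n * ξ n) P := by
    intro n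
    exact (hξi n).bdd_mul (hNm n) (hNbd n)
  have hcross : ∀ n, ∫ ω, (N n * ξ n) ω ∂P = 0 := by
    intro n
    -- Given `ℱ n`, the factor `N n` comes out and the conditional mean of `ξ n` is zero.
    rw [← integral_condExp (ℱ.le n)]
    refine integral_eq_zero_of_ae ?_
    filter_upwards [condExp_mul_of_stronglyMeasurable_left (hNadp n) (hNξ n) (hξi n), hce n]
      with ω h1 h2
    rw [h1]
    simp [h2]
  have hsqi : ∀ n, Integrable (fun ω => N n ω ^ 2) P := by
    intro n
    have h1 : Integrable (N n * N n) P := (hNi n).bdd_mul (hNm n) (hNbd n)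
    exact h1.congr (ae_of_all _ fun ω => by simp [sq])
  have hξsq : ∀ n, Integrable (fun ω => ξ n ω ^ 2) P := by
    intro n
    have h1 : Integrable (ξ n * ξ n) P := (hξi n).bdd_mul (hξm n) (hbd n)
    exact h1.congr (ae_of_all _ fun ω => by simp [sq])
  have hξsq_le : ∀ n, ∫ ω, ξ n ω ^ 2 ∂P ≤ C ^ 2 := by
    intro n
    have : ∫ ω, ξ n ω ^ 2 ∂P ≤ ∫ _, C ^ 2 ∂P := by
      refine integral_mono_ae (hξsq n) (integrable_const _) ?_
      filter_upwards [hbd n] with ω hω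
      exact sq_le_sq' (by linarith [(abs_le.1 hω).1]) (abs_le.1 hω).2
    simpa using this
  have hL2 : ∀ n, ∫ ω, N n ω ^ 2 ∂P ≤ C ^ 2 * ∑ s ∈ Finset.range n, r s ^ 2 := by
    intro n
    induction n with
    | zero => simp [hN]
    | succ n ih =>
      have h1 : ∀ ω, N (n + 1) ω ^ 2 =
          N n ω ^ 2 + 2 * r n * (N n * ξ n) ω + r n ^ 2 * ξ n ω ^ 2 := by
        intro ω; rw [hNs]; simp only [Pi.mul_apply]; ring
      simp only [h1]
      have h2 : Integrable (fun ω => N n ω ^ 2 + 2 * r n * (N n * ξ n) ω) P :=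
        (hsqi n).add ((hNξ n).const_mul _)
      rw [integral_add h2 ((hξsq n).const_mul _),
        integral_add (hsqi n) ((hNξ n).const_mul _), integral_const_mul, integral_const_mul,
        hcross, Finset.sum_range_succ]
      nlinarith [mul_le_mul_of_nonneg_left (hξsq_le n) (sq_nonneg (r n))]
  have hL1 : ∀ n, ∫ ω, |N n ω| ∂P ≤ 1 + C ^ 2 * ∑' s, r s ^ 2 := by
    intro n
    have h1 : ∫ ω, |N n ω| ∂P ≤ ∫ ω, (1 + N n ω ^ 2) ∂P := by
      refine integral_mono (hNi n).abs ((integrable_const _).add (hsqi n)) fun ω => ?_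
      rcases abs_cases (N n ω) with h | h <;> simp only [h.1] <;> nlinarith [sq_nonneg (N n ω - 1),
        sq_nonneg (N n ω + 1)]
    rw [integral_add (integrable_const _) (hsqi n)] at h1
    simp only [integral_const, probReal_univ, smul_eq_mul, mul_one] at h1
    have h2 := hL2 n
    have h3 : C ^ 2 * ∑ s ∈ Finset.range n, r s ^ 2 ≤ C ^ 2 * ∑' s, r s ^ 2 :=
      mul_le_mul_of_nonneg_left (hr.sum_le_tsum _ fun _ _ => sq_nonneg _) (sq_nonneg C)
    linarith
  exact hmart.submartingale.exists_ae_tendsto_of_bdd fun n =>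
    eLpNorm_one_le_of_integral_abs_le (hNi n) (hL1 n)

/-- A nonnegative supermartingale converges almost surely. -/
theorem Supermartingale.ae_exists_tendsto_of_nonneg {X : ℕ → Ω → ℝ} (hX : Supermartingale X ℱ P)
    (h0 : ∀ n, ∀ᵐ ω ∂P, 0 ≤ X n ω) : ∀ᵐ ω ∂P, ∃ l, Tendsto (fun n => X n ω) atTop (𝓝 l) := by
  have h1 : ∀ n, ∫ ω, |(-X) n ω| ∂P ≤ ∫ ω, X 0 ω ∂P := by
    intro n
    have h2 : ∫ ω, |(-X) n ω| ∂P = ∫ ω, X n ω ∂P := by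
      refine integral_congr_ae ?_
      filter_upwards [h0 n] with ω hω
      simp [abs_of_nonneg hω]
    rw [h2]
    have := hX.setIntegral_le (Nat.zero_le n) (MeasurableSet.univ (m := ℱ 0))
    simpa using this
  have h3 := hX.neg.exists_ae_tendsto_of_bdd fun n =>
    eLpNorm_one_le_of_integral_abs_le (hX.neg.integrable n) (h1 n)
  filter_upwards [h3] with ω ⟨c, hc⟩
  exact ⟨-c, by simpa using hc.neg⟩

end Noise


/-! ### Conditional law of one step given the past -/

namespace IsKPA

open KGraph

variable {Ω : Type*} [mΩ : MeasurableSpace Ω] {P : Measure Ω}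
  {K : ℕ} {p : Fin K → ℝ} {q γ α : ℝ} {G₀ : KGraph K} {G : ℕ → Ω → KGraph K}

theorem measurableSet_history (hG : IsKPA P p q γ α G₀ G) (t : ℕ) (h : ℕ → KGraph K) :
    MeasurableSet {ω | ∀ i ≤ t, G i ω = h i} := by
  have : {ω | ∀ i ≤ t, G i ω = h i} = ⋂ i ∈ Finset.range (t + 1), {ω | G i ω = h i} := by
    ext ω; simp
  rw [this]
  exact Finset.measurableSet_biInter _ fun i _ => hG.measurable i _

/-- A sequence of graphs which starts with the given graphs at the times `0, …, t`. -/
def extend {t : ℕ} (a : Fin (t + 1) → KGraph K) (i : ℕ) : KGraph K :=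
  a ⟨min i t, by omega⟩

theorem history_eq_iff {t : ℕ} (a : Fin (t + 1) → KGraph K) (g : ℕ → KGraph K) :
    (fun i : Fin (t + 1) => g i) = a ↔ ∀ i ≤ t, g i = extend a i := by
  constructor
  · rintro rfl i hi
    simp [extend, hi]
  · intro h
    ext1 i
    rw [h i (by omega)]
    simp only [extend]
    congr
    omega

/-- The filtration generated by the process. -/
def filtration (hG : IsKPA P p q γ α G₀ G) : Filtration ℕ mΩ where
  seq t := MeasurableSpace.comap (fun ω (i : Fin (t + 1)) => G i ω) ⊤
  mono' := by
    rintro s t hst _ ⟨A, -, rfl⟩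
    exact ⟨{h | (fun i : Fin (s + 1) => h ⟨i, by omega⟩) ∈ A}, trivial, rfl⟩
  le' := by
    rintro t _ ⟨A, -, rfl⟩
    -- There are countably many histories, so every event is a countable union of atoms.
    have h : (fun ω (i : Fin (t + 1)) => G i ω) ⁻¹' A =
        ⋃ a ∈ A, {ω | ∀ i ≤ t, G i ω = extend a i} := by
      ext ω
      simp only [Set.mem_preimage, Set.mem_iUnion, Set.mem_ofPred_eq, ← history_eq_iff, exists_prop]
      simp
    rw [h]
    exact MeasurableSet.biUnion A.to_countable fun a _ => hG.measurableSet_history t _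

theorem stronglyMeasurable_apply (hG : IsKPA P p q γ α G₀ G) {s t : ℕ} (hst : s ≤ t)
    (f : KGraph K → ℝ) : StronglyMeasurable[hG.filtration t] fun ω => f (G s ω) := by
  have h : Measurable[hG.filtration t] fun ω => f (G s ω) := by
    rintro A -
    exact ⟨{h | f (h ⟨s, by omega⟩) ∈ A}, trivial, rfl⟩
  exact h.stronglyMeasurable

theorem aestronglyMeasurable_apply (hG : IsKPA P p q γ α G₀ G) (t : ℕ)
    (f : KGraph K → ℝ) : AEStronglyMeasurable (fun ω => f (G t ω)) P :=
  ((hG.stronglyMeasurable_apply le_rfl f).mono (hG.filtration.le t)).aestronglyMeasurable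

theorem measureReal_move (hG : IsKPA P p q γ α G₀ G) (t : ℕ) (h : ℕ → KGraph K) (m : (h t).Move) :
    P.real ({ω | ∀ i ≤ t, G i ω = h i} ∩ {ω | G (t + 1) ω = (h t).move m}) =
      P.real {ω | ∀ i ≤ t, G i ω = h i} * (h t).moveProb p q γ α m := by
  rcases m with ⟨k, u⟩ | ⟨w, u⟩
  · exact hG.vertex_step t h k u
  · exact hG.edge_step t h w u

variable [IsProbabilityMeasure P] (hp : ∀ k, 0 ≤ p k) (hp1 : ∑ k, p k = 1) (hγ : γ ∈ Set.Ioc (0 : ℝ) 1)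
  (hα : α ∈ Set.Ioc (0 : ℝ) 1)

include hp hp1 hγ hα

/-- `IsKPA` prescribes only the probabilities of single moves. Different moves lead to different
graphs and the probabilities add up to 1, so no mass is left for any other successor. -/
theorem history_ae_eq_iUnion_move (hG : IsKPA P p q γ α G₀ G) (t : ℕ) (h : ℕ → KGraph K)
    (hreg : Regular p (h t)) :
    (⋃ m, {ω | ∀ i ≤ t, G i ω = h i} ∩ {ω | G (t + 1) ω = (h t).move m} : Set Ω) =ᵐ[P]
      {ω | ∀ i ≤ t, G i ω = h i} := by
  have hmeas : ∀ m, MeasurableSet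
      ({ω | ∀ i ≤ t, G i ω = h i} ∩ {ω | G (t + 1) ω = (h t).move m}) := fun m =>
    (hG.measurableSet_history t h).inter (hG.measurable _ _)
  refine ae_eq_of_subset_of_measure_ge (Set.iUnion_subset fun m => Set.inter_subset_left) ?_
    (MeasurableSet.iUnion hmeas).nullMeasurableSet (measure_ne_top _ _)
  have h1 : P.real {ω | ∀ i ≤ t, G i ω = h i} =
      P.real (⋃ m, {ω | ∀ i ≤ t, G i ω = h i} ∩ {ω | G (t + 1) ω = (h t).move m}) := by
    rw [measureReal_iUnion_fintype _ hmeas]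
    · simp only [hG.measureReal_move, ← Finset.mul_sum, sum_moveProb hγ hα hp hp1 hreg, mul_one]
    · intro m m' hne
      rw [Function.onFun, Set.disjoint_left]
      rintro ω ⟨-, h1⟩ ⟨-, h2⟩
      exact hne ((h t).move_injective (h1.symm.trans h2))
  exact ((measureReal_eq_measureReal_iff).1 h1).le

theorem setIntegral_history (hG : IsKPA P p q γ α G₀ G) (t : ℕ) (h : ℕ → KGraph K)
    (hreg : Regular p (h t)) (f : KGraph K → ℝ) :
    ∫ ω in {ω | ∀ i ≤ t, G i ω = h i}, f (G (t + 1) ω) ∂P =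
      P.real {ω | ∀ i ≤ t, G i ω = h i} * (h t).stepMean p q γ α f := by
  have hmeas : ∀ m, MeasurableSet
      ({ω | ∀ i ≤ t, G i ω = h i} ∩ {ω | G (t + 1) ω = (h t).move m}) := fun m =>
    (hG.measurableSet_history t h).inter (hG.measurable _ _)
  have hconst : ∀ m, Set.EqOn (fun ω => f (G (t + 1) ω)) (fun _ => f ((h t).move m))
      ({ω | ∀ i ≤ t, G i ω = h i} ∩ {ω | G (t + 1) ω = (h t).move m}) := by
    rintro m ω ⟨-, hω⟩
    exact congrArg f hω
  rw [← setIntegral_congr_set (history_ae_eq_iUnion_move hp hp1 hγ hα hG t h hreg),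
    integral_iUnion_fintype hmeas]
  · rw [stepMean, Finset.mul_sum]
    refine Finset.sum_congr rfl fun m _ => ?_
    rw [setIntegral_congr_fun (hmeas m) (hconst m), setIntegral_const, hG.measureReal_move,
      smul_eq_mul, mul_assoc]
  · intro m m' hne
    rw [Function.onFun, Set.disjoint_left]
    rintro ω ⟨-, h1⟩ ⟨-, h2⟩
    exact hne ((h t).move_injective (h1.symm.trans h2))
  · intro m
    exact (integrableOn_congr_fun (hconst m) (hmeas m)).2 (integrableOn_const (measure_ne_top _ _))

/-- Almost surely, a regular graph is followed by a graph obtained by a move of nonzero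
probability. -/
theorem ae_exists_move (hG : IsKPA P p q γ α G₀ G) (t : ℕ) :
    ∀ᵐ ω ∂P, Regular p (G t ω) →
      ∃ m, (G t ω).moveProb p q γ α m ≠ 0 ∧ G (t + 1) ω = (G t ω).move m := by
  -- One history at a time; the countably many exceptional null sets are united afterwards.
  have key : ∀ a : Fin (t + 1) → KGraph K, ∀ᵐ ω ∂P, (∀ i ≤ t, G i ω = extend a i) →
      Regular p (extend a t) → ∃ m, (extend a t).moveProb p q γ α m ≠ 0 ∧
        G (t + 1) ω = (extend a t).move m := by
    intro a
    generalize extend a = h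
    by_cases hreg : Regular p (h t)
    swap
    · exact ae_of_all _ fun ω _ hr => absurd hr hreg
    have h2 : ∀ m, ∀ᵐ ω ∂P, (h t).moveProb p q γ α m = 0 →
        ω ∉ ({ω | ∀ i ≤ t, G i ω = h i} ∩ {ω | G (t + 1) ω = (h t).move m}) := by
      intro m
      by_cases hm : (h t).moveProb p q γ α m = 0
      · have := hG.measureReal_move t h m
        rw [hm, mul_zero, measureReal_eq_zero_iff] at this
        filter_upwards [measure_eq_zero_iff_ae_notMem.1 this] with ω hω _ using hω
      · exact ae_of_all _ fun ω h0 => absurd h0 hm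
    filter_upwards [(history_ae_eq_iUnion_move hp hp1 hγ hα hG t h hreg).mem_iff,
      ae_all_iff.2 h2] with ω h3 h4 hω _
    obtain ⟨m, hm⟩ := Set.mem_iUnion.1 (h3.2 hω)
    exact ⟨m, fun h0 => h4 m h0 hm, hm.2⟩
  filter_upwards [ae_all_iff.2 key] with ω hω hreg
  have h1 : ∀ i ≤ t, G i ω = extend (fun i : Fin (t + 1) => G i ω) i :=
    (history_eq_iff _ fun i => G i ω).1 rfl
  have h2 := h1 t le_rfl
  have h3 := hω _ h1
  rw [← h2] at h3
  exact h3 hreg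

/-- The properties that almost every path of the process has at every time. -/
theorem ae_path (hG : IsKPA P p q γ α G₀ G) (hG₀ : Regular p G₀) :
    ∀ᵐ ω ∂P, G 0 ω = G₀ ∧ ∀ t, Regular p (G t ω) ∧
      ∃ m, (G t ω).moveProb p q γ α m ≠ 0 ∧ G (t + 1) ω = (G t ω).move m := by
  filter_upwards [hG.init, ae_all_iff.2 (ae_exists_move hp hp1 hγ hα hG)] with ω h0 h1
  refine ⟨h0, fun t => ?_⟩
  have hreg : Regular p (G t ω) := by
    induction t with
    | zero => rwa [h0]
    | succ t ih =>
      obtain ⟨m, hm, hmove⟩ := h1 t ih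
      rw [hmove]
      refine ih.move fun x hx => ?_
      subst hx
      refine (hp _).lt_of_ne fun h => hm ?_
      simp [moveProb, ← h]
  exact ⟨hreg, h1 t hreg⟩

/-- An event of the past is a countable disjoint union of histories, and on each of them `G t` is
constant, so both integrals are P(history) times the step mean. -/
theorem condExp_step (hG : IsKPA P p q γ α G₀ G) (hG₀ : Regular p G₀) (t : ℕ)
    (f : KGraph K → ℝ) (hf : Integrable (fun ω => f (G (t + 1) ω)) P)
    (hm : Integrable (fun ω => (G t ω).stepMean p q γ α f) P) :
    P[fun ω => f (G (t + 1) ω) | hG.filtration t] =ᵐ[P]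
      fun ω => (G t ω).stepMean p q γ α f := by
  symm
  refine ae_eq_condExp_of_forall_setIntegral_eq (hG.filtration.le t) hf
    (fun s _ _ => hm.integrableOn) ?_
    (hG.stronglyMeasurable_apply le_rfl fun g => g.stepMean p q γ α f).aestronglyMeasurable
  rintro _ ⟨A, -, rfl⟩ -
  have h : (fun ω (i : Fin (t + 1)) => G i ω) ⁻¹' A =
      ⋃ a : A, {ω | ∀ i ≤ t, G i ω = extend a.1 i} := by
    ext ω
    simp only [Set.mem_preimage, Set.mem_iUnion, Set.mem_ofPred_eq, ← history_eq_iff]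
    simp
  have hmeas : ∀ a : A, MeasurableSet {ω | ∀ i ≤ t, G i ω = extend a.1 i} := fun a =>
    hG.measurableSet_history t _
  have hdisj : Pairwise (Function.onFun Disjoint
      fun a : A => {ω | ∀ i ≤ t, G i ω = extend a.1 i}) := by
    intro a b hab
    rw [Function.onFun, Set.disjoint_left]
    intro ω ha hb
    simp only [Set.mem_ofPred_eq, ← history_eq_iff _ fun i => G i ω] at ha hb
    exact hab (Subtype.ext (ha.symm.trans hb))
  rw [h, integral_iUnion hmeas hdisj hm.integrableOn, integral_iUnion hmeas hdisj hf.integrableOn]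
  refine tsum_congr fun a => ?_
  generalize extend a.1 = h
  by_cases hz : P {ω | ∀ i ≤ t, G i ω = h i} = 0
  · rw [setIntegral_measure_zero _ hz, setIntegral_measure_zero _ hz]
  -- A history of positive probability cannot end in an irregular graph.
  · have hreg : Regular p (h t) := by
      by_contra hn
      refine hz (measure_mono_null ?_ (ae_iff.1 (ae_path hp hp1 hγ hα hG hG₀)))
      intro ω hω hc
      exact hn (hω t le_rfl ▸ (hc.2 t).1)
    rw [setIntegral_history hp hp1 hγ hα hG t h hreg, ← smul_eq_mul, ← setIntegral_const]
    refine setIntegral_congr_fun (hG.measurableSet_history t h) fun ω hω => ?_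
    simp only [hω t le_rfl]

end IsKPA


/-! ### Deterministic recursions -/

/-- Once e ≤ ε/2, each step multiplies the excess v - ε/2 by at most 1 - x ≤ exp(-x), and the sum of
the x diverges. -/
theorem tendsto_zero_of_le_contraction {v x e : ℕ → ℝ} (hv : ∀ t, 0 ≤ v t)
    (hx0 : ∀ t, 0 ≤ x t) (hx1 : ∀ t, x t ≤ 1)
    (hx : Tendsto (fun n => ∑ s ∈ Finset.range n, x s) atTop atTop)
    (he : Tendsto e atTop (𝓝 0)) (h : ∀ t, v (t + 1) ≤ (1 - x t) * v t + x t * e t) :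
    Tendsto v atTop (𝓝 0) := by
  rw [Metric.tendsto_atTop]
  intro ε hε
  obtain ⟨T, hT⟩ := Metric.tendsto_atTop.1 he (ε / 2) (by linarith)
  -- Truncated at 0 because replacing 1 - x by exp(-x) needs a nonnegative bound.
  set M := max (v T - ε / 2) 0 with hM
  have hM0 : 0 ≤ M := le_max_right _ _
  set S : ℕ → ℝ := fun n => ∑ s ∈ Finset.range n, x s with hS
  have key : ∀ n, v (T + n) - ε / 2 ≤ M * Real.exp (S T - S (T + n)) := by
    intro n
    induction n with
    | zero => simp [hM]
    | succ n ih =>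
      have h1 : e (T + n) ≤ ε / 2 := by
        have := hT (T + n) (by omega)
        rw [Real.dist_eq, sub_zero] at this
        exact (abs_lt.1 this).2.le
      have h2 : S (T + (n + 1)) = S (T + n) + x (T + n) := by
        rw [← add_assoc]; exact Finset.sum_range_succ _ _
      have h3 : v (T + n + 1) - ε / 2 ≤ (1 - x (T + n)) * (v (T + n) - ε / 2) := by
        have := h (T + n)
        have := mul_le_mul_of_nonneg_left h1 (hx0 (T + n))
        linarith
      have h4 : 1 - x (T + n) ≤ Real.exp (-x (T + n)) := Real.one_sub_le_exp_neg _
      have h5 : 0 ≤ 1 - x (T + n) := by linarith [hx1 (T + n)]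
      calc v (T + (n + 1)) - ε / 2 ≤ (1 - x (T + n)) * (v (T + n) - ε / 2) := h3
        _ ≤ (1 - x (T + n)) * (M * Real.exp (S T - S (T + n))) :=
            mul_le_mul_of_nonneg_left ih h5
        _ ≤ Real.exp (-x (T + n)) * (M * Real.exp (S T - S (T + n))) :=
            mul_le_mul_of_nonneg_right h4 (mul_nonneg hM0 (Real.exp_pos _).le)
        _ = M * (Real.exp (S T - S (T + n)) * Real.exp (-x (T + n))) := by ring
        _ = M * Real.exp (S T - S (T + (n + 1))) := by rw [← Real.exp_add, h2]; congr 2; ring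
  have h6 : Tendsto (fun n => M * Real.exp (S T - S n)) atTop (𝓝 0) := by
    have h7 : Tendsto (fun n => S T - S n) atTop atBot :=
      tendsto_atBot_add_const_left _ (S T) (tendsto_neg_atTop_atBot.comp hx)
    simpa using (Real.tendsto_exp_atBot.comp h7).const_mul M
  obtain ⟨N, hN⟩ := Metric.tendsto_atTop.1 h6 (ε / 2) (by linarith)
  refine ⟨T + N, fun n hn => ?_⟩
  obtain ⟨k, rfl⟩ := Nat.exists_eq_add_of_le (show T ≤ n by omega)
  have h8 := hN (T + k) (by omega)
  rw [Real.dist_eq, sub_zero] at h8 ⊢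
  rw [abs_of_nonneg (hv _)]
  have := key k
  have := (abs_lt.1 h8).2
  linarith

/-- The noise need not be absolutely summable. With e the partial sum of `d` minus its limit, b - e
satisfies the same recursion with noise -x e, and e → 0, so the previous lemma applies to |b - e|.
-/
theorem tendsto_zero_of_contraction_add_convergent {b x d : ℕ → ℝ} {l : ℝ}
    (hx0 : ∀ t, 0 ≤ x t) (hx1 : ∀ t, x t ≤ 1)
    (hx : Tendsto (fun n => ∑ s ∈ Finset.range n, x s) atTop atTop)
    (hd : Tendsto (fun n => ∑ s ∈ Finset.range n, d s) atTop (𝓝 l))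
    (h : ∀ t, b (t + 1) = (1 - x t) * b t + d t) : Tendsto b atTop (𝓝 0) := by
  set e : ℕ → ℝ := fun n => ∑ s ∈ Finset.range n, d s - l with he
  have he0 : Tendsto e atTop (𝓝 0) := by simpa [he] using hd.sub_const l
  have hes : ∀ t, e (t + 1) = e t + d t := by
    intro t; simp only [he, Finset.sum_range_succ]; ring
  have h1 : Tendsto (fun t => |b t - e t|) atTop (𝓝 0) := by
    refine tendsto_zero_of_le_contraction (fun t => abs_nonneg _) hx0 hx1 hx
      (by simpa using he0.abs) fun t => ?_
    have h2 : b (t + 1) - e (t + 1) = (1 - x t) * (b t - e t) - x t * e t := by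
      rw [h, hes]; ring
    rw [h2]
    refine (abs_sub _ _).trans ?_
    rw [abs_mul, abs_mul, abs_of_nonneg (hx0 t), abs_of_nonneg (sub_nonneg.2 (hx1 t))]
  simpa using ((tendsto_zero_iff_abs_tendsto_zero _).2 h1).add he0

/-- Kronecker's lemma for the weights `1, 2, 3, …`. -/
theorem tendsto_average_of_tendsto_sum_div {y : ℕ → ℝ} {l : ℝ}
    (h : Tendsto (fun n => ∑ s ∈ Finset.range n, ((s : ℝ) + 1)⁻¹ * y s) atTop (𝓝 l)) :
    Tendsto (fun n : ℕ => (n : ℝ)⁻¹ * ∑ s ∈ Finset.range n, y s) atTop (𝓝 0) := by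
  set N : ℕ → ℝ := fun n => ∑ s ∈ Finset.range n, ((s : ℝ) + 1)⁻¹ * y s with hN
  -- Abel summation. Divided by n, the right side is `N n` minus a Cesàro mean of `N`, and both tend
  -- to `l`.
  have h1 : ∀ n : ℕ, ∑ s ∈ Finset.range n, y s = n * N n - ∑ s ∈ Finset.range n, N s := by
    intro n
    induction n with
    | zero => simp
    | succ n ih =>
      rw [Finset.sum_range_succ, Finset.sum_range_succ, ih]
      have h2 : N (n + 1) = N n + ((n : ℝ) + 1)⁻¹ * y n := Finset.sum_range_succ _ _
      rw [h2]
      push_cast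
      have : (n : ℝ) + 1 ≠ 0 := by positivity
      field_simp
      ring
  have h3 : Tendsto (fun n : ℕ => N n - (n : ℝ)⁻¹ * ∑ s ∈ Finset.range n, N s) atTop (𝓝 0) := by
    simpa using h.sub h.cesaro
  refine h3.congr' ?_
  filter_upwards [eventually_ne_atTop 0] with n hn
  have : (n : ℝ) ≠ 0 := by exact_mod_cast hn
  rw [h1, mul_sub, inv_mul_cancel_left₀ this]

/-- Telescoping splits f(n) - f(0) into noise, negligible by Kronecker, and the sum of `d`, whose
average tends to `L` by Cesàro. -/
theorem tendsto_div_of_tendsto_increment {f d : ℕ → ℝ} {l L : ℝ}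
    (h : Tendsto (fun n => ∑ s ∈ Finset.range n, ((s : ℝ) + 1)⁻¹ * (f (s + 1) - f s - d s))
      atTop (𝓝 l)) (hd : Tendsto d atTop (𝓝 L)) :
    Tendsto (fun n : ℕ => f n / n) atTop (𝓝 L) := by
  have h1 := ((tendsto_average_of_tendsto_sum_div h).add hd.cesaro).add
    (tendsto_inv_atTop_nhds_zero_nat.mul_const (f 0))
  simp only [zero_add, zero_mul, add_zero] at h1
  refine h1.congr fun n => ?_
  rw [← mul_add, ← Finset.sum_add_distrib, ← mul_add]
  have h2 : ∑ s ∈ Finset.range n, (f (s + 1) - f s - d s + d s) = f n - f 0 := by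
    simp only [sub_add_cancel]
    exact Finset.sum_range_sub f n
  rw [h2, sub_add_cancel, mul_comm, div_eq_mul_inv]

theorem summable_inv_add_one_sq : Summable fun s : ℕ => ((s : ℝ) + 1)⁻¹ ^ 2 := by
  have h := (summable_nat_add_iff 1).2 (Real.summable_nat_pow_inv.2 (by norm_num : 1 < 2))
  simpa [inv_pow] using h

/-- If `c` is the initial total degree, c + 2s + 2 is the total degree at time s + 1. -/
theorem summable_inv_affine_sq (c : ℝ) (hc : 0 ≤ c) :
    Summable fun s : ℕ => (c + 2 * s + 2)⁻¹ ^ 2 := by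
  refine Summable.of_nonneg_of_le (fun s => sq_nonneg _) (fun s => ?_) summable_inv_add_one_sq
  have : (0 : ℝ) ≤ s := by positivity
  exact pow_le_pow_left₀ (by positivity) (inv_anti₀ (by positivity) (by linarith)) 2

theorem tendsto_sum_inv_affine (c : ℝ) (hc : 0 ≤ c) :
    Tendsto (fun n => ∑ s ∈ Finset.range n, (c + 2 * s + 2)⁻¹) atTop atTop := by
  have h := (Real.tendsto_sum_range_one_div_nat_succ_atTop).const_mul_atTop
    (show 0 < (c + 2)⁻¹ by positivity)
  refine tendsto_atTop_mono (fun n => ?_) h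
  rw [Finset.mul_sum]
  refine Finset.sum_le_sum fun s _ => ?_
  rw [one_div, ← mul_inv]
  have : (0 : ℝ) ≤ s := by positivity
  gcongr
  nlinarith

/-! ### Almost sure behaviour of the counts -/

namespace IsKPA

open KGraph

variable {Ω : Type*} [mΩ : MeasurableSpace Ω] {P : Measure Ω}
  {K : ℕ} {p : Fin K → ℝ} {q γ α : ℝ} {G₀ : KGraph K} {G : ℕ → Ω → KGraph K}
  [IsProbabilityMeasure P] (hp : ∀ k, 0 ≤ p k) (hp1 : ∑ k, p k = 1) (hγ : γ ∈ Set.Ioc (0 : ℝ) 1)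
  (hα : α ∈ Set.Ioc (0 : ℝ) 1) (hq : q ∈ Set.Icc (0 : ℝ) 1)

include hp hp1 hγ hα hq

/-- The terms are weighted martingale differences. As `φ` takes finitely many values, some B bounds
every increment, hence also the drift, which is an average of increments. -/
theorem ae_exists_tendsto_sum_increment (hG : IsKPA P p q γ α G₀ G) (hG₀ : Regular p G₀)
    {f : KGraph K → ℝ} {φ : Bool → Fin K → Fin K → ℝ} (hf : HasIncrement f φ)
    {r : ℕ → ℝ} (hr : Summable fun t => r t ^ 2) :
    ∀ᵐ ω ∂P, ∃ l, Tendsto (fun n => ∑ s ∈ Finset.range n, r s * (f (G (s + 1) ω) - f (G s ω) -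
      drift p q (γ / (γ + α * (1 - γ))) (G s ω).share φ)) atTop (𝓝 l) := by
  have hpath := ae_path hp hp1 hγ hα hG hG₀
  obtain ⟨B, hB⟩ : ∃ B, ∀ v j l, |φ v j l| ≤ B := by
    refine ⟨∑ v, ∑ j, ∑ l, |φ v j l|, fun v j l => ?_⟩
    have h1 := Finset.single_le_sum (f := fun v => ∑ j, ∑ l, |φ v j l|)
      (fun i _ => by positivity) (Finset.mem_univ v)
    have h2 := Finset.single_le_sum (f := fun j => ∑ l, |φ v j l|)
      (fun i _ => by positivity) (Finset.mem_univ j)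
    have h3 := Finset.single_le_sum (f := fun l => |φ v j l|)
      (fun i _ => by positivity) (Finset.mem_univ l)
    linarith
  have hinc : ∀ (g : KGraph K) m, |g.moveInc φ m| ≤ B := by
    rintro g (m | m) <;> exact hB _ _ _
  have hdrift : ∀ g : KGraph K, Regular p g →
      |drift p q (γ / (γ + α * (1 - γ))) g.share φ| ≤ B := by
    intro g hg
    rw [← sum_moveProb_mul_moveInc hγ hα hp hg φ]
    refine (Finset.abs_sum_le_sum_abs _ _).trans ?_
    calc ∑ m, |g.moveProb p q γ α m * g.moveInc φ m| ≤ ∑ m, g.moveProb p q γ α m * B := by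
          refine Finset.sum_le_sum fun m _ => ?_
          have h0 := moveProb_nonneg hγ hα hp hq hg m
          rw [abs_mul, abs_of_nonneg h0]
          exact mul_le_mul_of_nonneg_left (hinc g m) h0
      _ = B := by rw [← Finset.sum_mul, sum_moveProb hγ hα hp hp1 hg, one_mul]
  have hfb : ∀ t, ∀ᵐ ω ∂P, |f (G t ω)| ≤ |f G₀| + t * B := by
    intro t
    filter_upwards [hpath] with ω ⟨h0, h⟩
    induction t with
    | zero => simp [h0]
    | succ t ih =>
      obtain ⟨-, m, -, hm⟩ := h t
      rw [hm, hf]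
      have := abs_add_le (f (G t ω)) (moveInc (G t ω) φ m)
      have := hinc (G t ω) m
      push_cast
      linarith
  have hfi : ∀ t, Integrable (fun ω => f (G t ω)) P := fun t =>
    integrable_of_ae_abs_le (hG.aestronglyMeasurable_apply t f) (hfb t)
  have hmi : ∀ t, Integrable (fun ω => (G t ω).stepMean p q γ α f) P := by
    intro t
    refine integrable_of_ae_abs_le (C := |f G₀| + t * B + B)
      (hG.aestronglyMeasurable_apply t fun g => g.stepMean p q γ α f) ?_
    filter_upwards [hpath, hfb t] with ω h h1
    rw [stepMean_of_hasIncrement hγ hα hp hp1 (h.2 t).1 hf]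
    have := abs_add_le (f (G t ω)) (drift p q (γ / (γ + α * (1 - γ))) (G t ω).share φ)
    have := hdrift _ (h.2 t).1
    linarith
  have hbd : ∀ t, ∀ᵐ ω ∂P, |f (G (t + 1) ω) - (G t ω).stepMean p q γ α f| ≤ B + B := by
    intro t
    filter_upwards [hpath] with ω h
    obtain ⟨hreg, m, -, hm⟩ := h.2 t
    rw [stepMean_of_hasIncrement hγ hα hp hp1 hreg hf, hm, hf, add_sub_add_left_eq_sub]
    exact (abs_sub _ _).trans (add_le_add (hinc _ _) (hdrift _ hreg))
  have hce : ∀ t, P[fun ω => f (G (t + 1) ω) - (G t ω).stepMean p q γ α f | hG.filtration t]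
      =ᵐ[P] 0 := by
    intro t
    refine (condExp_sub (hfi (t + 1)) (hmi t) _).trans ?_
    filter_upwards [condExp_step hp hp1 hγ hα hG hG₀ t f (hfi (t + 1)) (hmi t)] with ω h
    rw [Pi.sub_apply, h, condExp_of_stronglyMeasurable (hG.filtration.le t)
      (hG.stronglyMeasurable_apply le_rfl fun g => g.stepMean p q γ α f) (hmi t)]
    simp
  have hseries := ae_exists_tendsto_sum_mul_of_martingale_difference (ℱ := hG.filtration)
    (ξ := fun t ω => f (G (t + 1) ω) - (G t ω).stepMean p q γ α f) (C := B + B)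
    (fun t => (hG.stronglyMeasurable_apply le_rfl f).sub
      (hG.stronglyMeasurable_apply (Nat.le_succ t) fun g => g.stepMean p q γ α f)) hbd hce hr
  filter_upwards [hseries, hpath] with ω ⟨l, hl⟩ h
  refine ⟨l, hl.congr fun n => Finset.sum_congr rfl fun s _ => ?_⟩
  rw [stepMean_of_hasIncrement hγ hα hp hp1 (h.2 s).1 hf, sub_sub]

/-- If `f` is bounded at each time and nonnegative, and does not grow in the mean, then it converges
along almost every path. -/
theorem ae_exists_tendsto_of_stepMean_le (hG : IsKPA P p q γ α G₀ G) (hG₀ : Regular p G₀)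
    {f : KGraph K → ℝ} (hf0 : ∀ g, Regular p g → 0 ≤ f g) {C : ℕ → ℝ}
    (hC : ∀ t, ∀ᵐ ω ∂P, f (G t ω) ≤ C t)
    (hf : ∀ g, Regular p g → g.stepMean p q γ α f ≤ f g) :
    ∀ᵐ ω ∂P, ∃ l, Tendsto (fun n => f (G n ω)) atTop (𝓝 l) := by
  have hpath := ae_path hp hp1 hγ hα hG hG₀
  have h0 : ∀ t, ∀ᵐ ω ∂P, 0 ≤ f (G t ω) := by
    intro t
    filter_upwards [hpath] with ω h
    exact hf0 _ (h.2 t).1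
  have hfi : ∀ t, Integrable (fun ω => f (G t ω)) P := by
    intro t
    refine integrable_of_ae_abs_le (C := C t) (hG.aestronglyMeasurable_apply t f) ?_
    filter_upwards [h0 t, hC t] with ω h1 h2
    rwa [abs_of_nonneg h1]
  have hmi : ∀ t, Integrable (fun ω => (G t ω).stepMean p q γ α f) P := by
    intro t
    refine integrable_of_ae_abs_le (C := C t)
      (hG.aestronglyMeasurable_apply t fun g => g.stepMean p q γ α f) ?_
    filter_upwards [hpath, hC t] with ω h h2
    have hreg := (h.2 t).1
    rw [abs_of_nonneg]
    · exact (hf _ hreg).trans h2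
    · refine Finset.sum_nonneg fun m _ => ?_
      -- A move of probability zero may lead to an irregular graph, where `f` could be negative.
      by_cases hm : (G t ω).moveProb p q γ α m = 0
      · simp [hm]
      · refine mul_nonneg (moveProb_nonneg hγ hα hp hq hreg m) (hf0 _ (hreg.move ?_))
        rintro x rfl
        refine (hp _).lt_of_ne fun h => hm ?_
        simp [moveProb, ← h]
  refine Supermartingale.ae_exists_tendsto_of_nonneg (X := fun n ω => f (G n ω))
    (ℱ := hG.filtration)
    (supermartingale_nat (fun t => hG.stronglyMeasurable_apply le_rfl f) hfi fun t => ?_) h0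
  filter_upwards [hpath, condExp_step hp hp1 hγ hα hG hG₀ t f (hfi (t + 1)) (hmi t)] with ω h h1
  rw [h1]
  exact hf _ (h.2 t).1

end IsKPA


/-! ### A supermartingale that keeps the shares away from zero -/

namespace KGraph

variable {K : ℕ} {p : Fin K → ℝ} {q γ α : ℝ}

/-- A function of the degree share of group `k` which blows up when the share vanishes, and which
does not grow in the mean if all steps are edge-steps. -/
def sharePotential (k : Fin K) (g : KGraph K) : ℝ :=
  Real.log ((g.totalDeg : ℝ) / g.groupDeg k) + 2 / g.groupDeg k

/-- Bounding log((D + δ)/D) below by δ/(D + δ) instead of δ/D loses δ²/(D(D + δ)). The summand 2/D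
falls by 2δ/(D(D + δ)), which pays for the loss because δ ≤ 2. -/
theorem log_div_add_two_div_le {S D δ : ℝ} (hS : 0 < S) (hD : 0 < D) (h0 : 0 ≤ δ) (h2 : δ ≤ 2) :
    Real.log ((S + 2) / (D + δ)) + 2 / (D + δ) ≤
      Real.log (S / D) + 2 / D + 2 / S - δ / D := by
  have hDδ : 0 < D + δ := by linarith
  have h1 : Real.log ((S + 2) / (D + δ)) =
      Real.log (S / D) + Real.log ((S + 2) / S) - Real.log ((D + δ) / D) := by
    rw [Real.log_div (by positivity) hDδ.ne', Real.log_div hS.ne' hD.ne',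
      Real.log_div (by positivity) hS.ne', Real.log_div hDδ.ne' hD.ne']
    ring
  have h3 : Real.log ((S + 2) / S) ≤ 2 / S := by
    refine (Real.log_le_sub_one_of_pos (by positivity)).trans_eq ?_
    field_simp
    ring
  have h4 : δ / (D + δ) ≤ Real.log ((D + δ) / D) := by
    refine le_trans (le_of_eq ?_) (Real.one_sub_inv_le_log_of_pos (by positivity))
    field_simp
    ring
  have h5 : 2 / (D + δ) - δ / (D + δ) = 2 / D - δ / D - δ * (2 - δ) / (D * (D + δ)) := by
    field_simp
    ring
  have h6 : 0 ≤ δ * (2 - δ) / (D * (D + δ)) :=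
    div_nonneg (mul_nonneg h0 (by linarith)) (by positivity)
  linarith

theorem sharePotential_nonneg {g : KGraph K} {k : Fin K} (hk : 0 < g.groupDeg k) :
    0 ≤ sharePotential k g := by
  have h1 := g.groupDeg_add_otherDeg k
  have h2 : (g.groupDeg k : ℝ) ≤ g.totalDeg := by exact_mod_cast (by omega)
  have hk' : (0 : ℝ) < g.groupDeg k := by exact_mod_cast hk
  have h3 : 1 ≤ (g.totalDeg : ℝ) / g.groupDeg k := (one_le_div hk').2 h2
  have := Real.log_nonneg h3
  unfold sharePotential
  positivity

/-- A bound depending only on the total degree, hence deterministic at each time; it serves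
integrability. -/
theorem sharePotential_le {g : KGraph K} {k : Fin K} (hk : 0 < g.groupDeg k) :
    sharePotential k g ≤ Real.log g.totalDeg + 2 := by
  have h1 := g.groupDeg_add_otherDeg k
  have hS : (0 : ℝ) < g.totalDeg := by exact_mod_cast (by omega : 0 < g.totalDeg)
  have hk' : (1 : ℝ) ≤ g.groupDeg k := by exact_mod_cast hk
  have h2 : (g.totalDeg : ℝ) / g.groupDeg k ≤ g.totalDeg := div_le_self hS.le hk'
  have h3 : 2 / (g.groupDeg k : ℝ) ≤ 2 := div_le_self (by norm_num) hk'
  exact add_le_add (Real.log_le_log (by positivity) h2) h3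

/-- For q = 0 the mean increment of D is 2D/S, so in the mean the gain 2/S and the loss δ/D cancel
exactly. -/
theorem stepMean_sharePotential_le (hγ : γ ∈ Set.Ioc (0 : ℝ) 1) (hα : α ∈ Set.Ioc (0 : ℝ) 1)
    (hp : ∀ k, 0 ≤ p k) (hp1 : ∑ k, p k = 1) {g : KGraph K} (h : Regular p g) {k : Fin K}
    (hk : 0 < p k) : g.stepMean p 0 γ α (sharePotential k) ≤ sharePotential k g := by
  have hD : (0 : ℝ) < g.groupDeg k := by exact_mod_cast h.groupDeg_pos k hk
  have hS' := h.totalDeg_pos hp1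
  have hS : (0 : ℝ) < g.totalDeg := by exact_mod_cast hS'
  set φ : Bool → Fin K → Fin K → ℝ := fun _ j l => (if j = k then 1 else 0) + if l = k then 1 else 0
  have hφ : ∀ m, 0 ≤ g.moveInc φ m ∧ g.moveInc φ m ≤ 2 := by
    rintro (m | m) <;> simp only [moveInc, φ] <;> split_ifs <;> norm_num
  have hmove : ∀ m, sharePotential k (g.move m) ≤
      sharePotential k g + 2 / g.totalDeg - g.moveInc φ m * (g.groupDeg k : ℝ)⁻¹ := by
    intro m
    have h1 := hasIncrement_groupDeg k g m
    simp only at h1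
    unfold sharePotential
    rw [h1, totalDeg_move, ← div_eq_mul_inv]
    push_cast
    exact log_div_add_two_div_le hS hD (hφ m).1 (hφ m).2
  have hsum := sum_moveProb_mul_moveInc (q := 0) hγ hα hp h φ
  rw [drift_groupDeg _ (sum_share hS') hp1] at hsum
  calc g.stepMean p 0 γ α (sharePotential k)
      ≤ ∑ m, g.moveProb p 0 γ α m *
        (sharePotential k g + 2 / g.totalDeg - g.moveInc φ m * (g.groupDeg k : ℝ)⁻¹) :=
        Finset.sum_le_sum fun m _ => mul_le_mul_of_nonneg_left (hmove m)
          (moveProb_nonneg hγ hα hp (by simp) h m)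
    _ = sharePotential k g + 2 / g.totalDeg - 2 * g.share k * (g.groupDeg k : ℝ)⁻¹ := by
        simp only [mul_sub, Finset.sum_sub_distrib, ← Finset.sum_mul, ← mul_assoc, hsum,
          sum_moveProb hγ hα hp hp1 h]
        ring
    _ = sharePotential k g := by
        rw [share]
        field_simp
        ring

end KGraph

/-! ### Limits of the degree shares and of the counts -/

namespace IsKPA

open KGraph

variable {Ω : Type*} [mΩ : MeasurableSpace Ω] {P : Measure Ω}
  {K : ℕ} {p : Fin K → ℝ} {q γ α : ℝ} {G₀ : KGraph K} {G : ℕ → Ω → KGraph K}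
  [IsProbabilityMeasure P] (hp : ∀ k, 0 ≤ p k) (hp1 : ∑ k, p k = 1) (hγ : γ ∈ Set.Ioc (0 : ℝ) 1)
  (hα : α ∈ Set.Ioc (0 : ℝ) 1) (hq : q ∈ Set.Icc (0 : ℝ) 1)

include hp hp1 hγ hα

theorem ae_totalDeg_numEdges (hG : IsKPA P p q γ α G₀ G) (hG₀ : Regular p G₀) :
    ∀ᵐ ω ∂P, ∀ t, (G t ω).totalDeg = G₀.totalDeg + 2 * t ∧
      (G t ω).numEdges = G₀.numEdges + t := by
  filter_upwards [ae_path hp hp1 hγ hα hG hG₀] with ω ⟨h0, h⟩ t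
  induction t with
  | zero => simp [h0]
  | succ t ih =>
    obtain ⟨-, m, -, hm⟩ := h t
    rw [hm, totalDeg_move, numEdges_move, ih.1, ih.2]
    omega

/-- Without vertex-steps, no nodes arrive. -/
theorem ae_groupSize_eq_of_q_eq_zero (hG : IsKPA P p 0 γ α G₀ G) (hG₀ : Regular p G₀) :
    ∀ᵐ ω ∂P, ∀ t, (G t ω).n = G₀.n ∧ ∀ k, (G t ω).groupSize k = G₀.groupSize k := by
  filter_upwards [ae_path hp hp1 hγ hα hG hG₀] with ω ⟨h0, h⟩ t
  induction t with
  | zero => simp [h0]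
  | succ t ih =>
    obtain ⟨-, m | m, hne, hm⟩ := h t
    · simp [moveProb] at hne
    · rw [hm]
      exact ih

theorem ae_exists_tendsto_sharePotential (hG : IsKPA P p 0 γ α G₀ G) (hG₀ : Regular p G₀)
    {k : Fin K} (hk : 0 < p k) :
    ∀ᵐ ω ∂P, ∃ l, Tendsto (fun n => sharePotential k (G n ω)) atTop (𝓝 l) := by
  refine ae_exists_tendsto_of_stepMean_le hp hp1 hγ hα (by simp) hG hG₀
    (fun g hg => sharePotential_nonneg (hg.groupDeg_pos k hk))
    (C := fun t => Real.log (G₀.totalDeg + 2 * t) + 2) (fun t => ?_)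
    fun g hg => stepMean_sharePotential_le hγ hα hp hp1 hg hk
  filter_upwards [ae_path hp hp1 hγ hα hG hG₀, ae_totalDeg_numEdges hp hp1 hγ hα hG hG₀]
    with ω h h1
  have h2 := sharePotential_le ((h.2 t).1.groupDeg_pos k hk)
  rw [(h1 t).1] at h2
  exact_mod_cast h2

include hq

/-- The recursion of the degree shares. -/
theorem ae_share_recursion (hG : IsKPA P p q γ α G₀ G) (hG₀ : Regular p G₀) (k : Fin K) :
    ∀ᵐ ω ∂P, ∃ (d : ℕ → ℝ) (l : ℝ), Tendsto (fun n => ∑ s ∈ Finset.range n, d s) atTop (𝓝 l) ∧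
      ∀ t, (G (t + 1) ω).share k - p k =
        (1 - q * (2 - γ / (γ + α * (1 - γ))) * ((G₀.totalDeg : ℝ) + 2 * t + 2)⁻¹) *
          ((G t ω).share k - p k) + d t := by
  filter_upwards [ae_path hp hp1 hγ hα hG hG₀, ae_totalDeg_numEdges hp hp1 hγ hα hG hG₀,
    ae_exists_tendsto_sum_increment hp hp1 hγ hα hq hG hG₀ (hasIncrement_groupDeg k)
      (summable_inv_affine_sq G₀.totalDeg (Nat.cast_nonneg _))] with ω h hS ⟨l, hl⟩
  -- The noise `d t` is the centred increment of the group degree divided by the total degree after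
  -- the step.
  refine ⟨_, l, hl, fun t => ?_⟩
  have hpos := (h.2 t).1.totalDeg_pos hp1
  rw [drift_groupDeg _ (sum_share hpos) hp1]
  have h1 : ((G t ω).groupDeg k : ℝ) = (G t ω).share k * (G₀.totalDeg + 2 * t) := by
    have h2 : ((G t ω).totalDeg : ℝ) = G₀.totalDeg + 2 * t := by exact_mod_cast (hS t).1
    rw [share, h2, div_mul_cancel₀]
    rw [← h2]
    exact_mod_cast hpos.ne'
  have h3 : (G (t + 1) ω).share k =
      (G (t + 1) ω).groupDeg k * ((G₀.totalDeg : ℝ) + 2 * t + 2)⁻¹ := by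
    have h2 : ((G (t + 1) ω).totalDeg : ℝ) = G₀.totalDeg + 2 * t + 2 := by
      rw [(hS (t + 1)).1]; push_cast; ring
    rw [share, h2, div_eq_mul_inv]
  rw [h1, h3]
  have h4 : ((G₀.totalDeg : ℝ) + 2 * t + 2) ≠ 0 := by positivity
  generalize γ / (γ + α * (1 - γ)) = θ
  field_simp
  ring

/-- The degree shares converge, and the limits for the groups of positive probability are
positive. -/
theorem ae_exists_tendsto_share (hG : IsKPA P p q γ α G₀ G) (hG₀ : Regular p G₀) (k : Fin K) :
    ∀ᵐ ω ∂P, ∃ a, Tendsto (fun t => (G t ω).share k) atTop (𝓝 a) ∧ (0 < p k → 0 < a) := by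
  rcases hq.1.lt_or_eq with hq0 | rfl
  · filter_upwards [ae_share_recursion hp hp1 hγ hα hq hG hG₀ k] with ω ⟨d, l, hd, h⟩
    obtain ⟨hγ0, hγ1⟩ := hγ
    obtain ⟨hα0, hα1⟩ := hα
    have h0 : 0 ≤ α * (1 - γ) := mul_nonneg hα0.le (by linarith)
    have hθ0 : 0 ≤ γ / (γ + α * (1 - γ)) := by positivity
    have hθ1 : γ / (γ + α * (1 - γ)) ≤ 1 := div_le_one_of_le₀ (by linarith) (by linarith)
    have hc0 : 0 < q * (2 - γ / (γ + α * (1 - γ))) := mul_pos hq0 (by linarith)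
    have hc2 : q * (2 - γ / (γ + α * (1 - γ))) ≤ 2 := by nlinarith [hq.2]
    have hS : (0 : ℝ) ≤ G₀.totalDeg := Nat.cast_nonneg _
    refine ⟨p k, ?_, id⟩
    have := tendsto_zero_of_contraction_add_convergent
      (x := fun t => q * (2 - γ / (γ + α * (1 - γ))) * ((G₀.totalDeg : ℝ) + 2 * t + 2)⁻¹)
      (b := fun t => (G t ω).share k - p k) (fun t => by positivity) (fun t => ?_) ?_ hd h
    · simpa using this.add_const (p k)
    · rw [← div_eq_mul_inv]
      exact div_le_one_of_le₀ (by linarith [(Nat.cast_nonneg t : (0 : ℝ) ≤ t)]) (by positivity)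
    · simp only [← Finset.mul_sum]
      exact (tendsto_sum_inv_affine _ hS).const_mul_atTop hc0
  · have hΦ : ∀ᵐ ω ∂P, 0 < p k →
        ∃ l, Tendsto (fun n => sharePotential k (G n ω)) atTop (𝓝 l) := by
      by_cases hk : 0 < p k
      · filter_upwards [ae_exists_tendsto_sharePotential hp hp1 hγ hα hG hG₀ hk] with ω h _ using h
      · exact ae_of_all _ fun ω h => absurd h hk
    filter_upwards [ae_share_recursion hp hp1 hγ hα hq hG hG₀ k, hΦ,
      ae_path hp hp1 hγ hα hG hG₀] with ω ⟨d, l, hd, h⟩ hl hpath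
    -- For q = 0 there is no contraction: the share is its initial value plus the convergent noise.
    have h1 : ∀ n, (G n ω).share k = (G 0 ω).share k + ∑ s ∈ Finset.range n, d s := by
      intro n
      induction n with
      | zero => simp
      | succ n ih =>
        have := h n
        rw [Finset.sum_range_succ]
        linarith
    have h2 : Tendsto (fun t => (G t ω).share k) atTop (𝓝 ((G 0 ω).share k + l)) :=
      (hd.const_add _).congr fun n => (h1 n).symm
    refine ⟨_, h2, fun hk => ?_⟩
    obtain ⟨L, hL⟩ := hl hk
    -- The potential is eventually below L + 1 and dominates -log of the share.
    refine (Real.exp_pos (-(L + 1))).trans_le (ge_of_tendsto h2 ?_)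
    filter_upwards [hL.eventually (gt_mem_nhds (lt_add_one L))] with n hn
    have hreg := (hpath.2 n).1
    have hD : (0 : ℝ) < (G n ω).groupDeg k := by exact_mod_cast hreg.groupDeg_pos k hk
    have hS : (0 : ℝ) < (G n ω).totalDeg := by exact_mod_cast hreg.totalDeg_pos hp1
    have h3 : Real.log (((G n ω).totalDeg : ℝ) / (G n ω).groupDeg k) ≤ L + 1 := by
      have h4 : (0 : ℝ) ≤ 2 / (G n ω).groupDeg k := by positivity
      unfold sharePotential at hn
      linarith
    have h5 : Real.log ((G n ω).share k) =
        -Real.log (((G n ω).totalDeg : ℝ) / (G n ω).groupDeg k) := by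
      rw [← Real.log_inv, inv_div, share]
    have h6 : 0 < (G n ω).share k := div_pos hD hS
    refine (Real.le_log_iff_exp_le h6).1 ?_
    linarith

/-- The null set comes from the noise series alone, so `L` may be quantified inside and depend on
the path, as it does when the limit shares are random. -/
theorem ae_tendsto_div (hG : IsKPA P p q γ α G₀ G) (hG₀ : Regular p G₀)
    {f : KGraph K → ℝ} {φ : Bool → Fin K → Fin K → ℝ} (hf : HasIncrement f φ) :
    ∀ᵐ ω ∂P, ∀ L, Tendsto (fun t => drift p q (γ / (γ + α * (1 - γ))) (G t ω).share φ) atTop (𝓝 L) →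
      Tendsto (fun t : ℕ => f (G t ω) / t) atTop (𝓝 L) := by
  filter_upwards [ae_exists_tendsto_sum_increment hp hp1 hγ hα hq hG hG₀ hf
    summable_inv_add_one_sq] with ω ⟨l, hl⟩ L hL
  exact tendsto_div_of_tendsto_increment hl hL

/-- The limits of all counts along almost every path. -/
theorem ae_exists_limits (hG : IsKPA P p q γ α G₀ G) (hG₀ : Regular p G₀) :
    ∀ᵐ ω ∂P, ∃ a : Fin K → ℝ, (∀ k, 0 < p k → 0 < a k) ∧
      (∀ k, Tendsto (fun t => (G t ω).share k) atTop (𝓝 (a k))) ∧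
      Tendsto (fun t : ℕ => ((G t ω).n : ℝ) / t) atTop (𝓝 q) ∧
      (∀ k, Tendsto (fun t : ℕ => ((G t ω).groupSize k : ℝ) / t) atTop (𝓝 (q * p k))) ∧
      (∀ k, Tendsto (fun t : ℕ => ((G t ω).innerEdges k : ℝ) / t) atTop
        (𝓝 ((q * p k + (1 - q) * a k) * (1 - γ / (γ + α * (1 - γ)) * (1 - a k))))) ∧
      ∀ k, Tendsto (fun t : ℕ => ((G t ω).outerEdges k : ℝ) / t) atTop
        (𝓝 ((q * p k + (1 - q) * a k) * (γ / (γ + α * (1 - γ)) * (1 - a k)))) := by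
  filter_upwards [ae_path hp hp1 hγ hα hG hG₀,
    ae_all_iff.2 (ae_exists_tendsto_share hp hp1 hγ hα hq hG hG₀),
    ae_tendsto_div hp hp1 hγ hα hq hG hG₀ hasIncrement_n,
    ae_all_iff.2 fun k => ae_tendsto_div hp hp1 hγ hα hq hG hG₀ (hasIncrement_groupSize k),
    ae_all_iff.2 fun k => ae_tendsto_div hp hp1 hγ hα hq hG hG₀ (hasIncrement_innerEdges k),
    ae_all_iff.2 fun k => ae_tendsto_div hp hp1 hγ hα hq hG hG₀ (hasIncrement_outerEdges k)]
    with ω hpath hshare hn hV hin hout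
  choose a ha hapos using hshare
  have hsum : ∀ t, ∑ k, (G t ω).share k = 1 := fun t =>
    sum_share ((hpath.2 t).1.totalDeg_pos hp1)
  refine ⟨a, hapos, ha, hn q ?_, fun k => hV k _ ?_, fun k => hin k _ ?_, fun k => hout k _ ?_⟩
  · simp only [drift_n _ (hsum _) hp1, tendsto_const_nhds]
  · simp only [drift_groupSize _ (hsum _), tendsto_const_nhds]
  · simp only [drift_innerEdges]
    generalize γ / (γ + α * (1 - γ)) = θ
    exact ((by fun_prop : Continuous fun x : ℝ =>
      (q * p k + (1 - q) * x) * (1 - θ * (1 - x))).tendsto (a k)).comp (ha k)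
  · simp only [drift_outerEdges _ (hsum _)]
    generalize γ / (γ + α * (1 - γ)) = θ
    exact ((by fun_prop : Continuous fun x : ℝ =>
      (q * p k + (1 - q) * x) * (θ * (1 - x))).tendsto (a k)).comp (ha k)

end IsKPA


namespace KGraph

variable {K : ℕ}

/-! ### The snapshot likelihood -/

/-- The degree share of group `k` as it appears in the likelihood. -/
def edgeShare (G : KGraph K) (k : Fin K) : ℝ := (G.groupDeg k : ℝ) / (2 * G.numEdges)

/-- `θ` times the derivative of the snapshot likelihood. -/
def score (G : KGraph K) (θ : ℝ) : ℝ :=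
  ∑ k, ((G.outerEdges k : ℝ) -
    G.innerEdges k * (θ * (1 - G.edgeShare k) / (1 - θ * (1 - G.edgeShare k))))

/-- Every group either has no edges or has a degree share strictly between `0` and `1`. -/
def Nondegenerate (G : KGraph K) : Prop :=
  ∀ k, (G.innerEdges k = 0 ∧ G.outerEdges k = 0) ∨ (0 < G.edgeShare k ∧ G.edgeShare k < 1)

theorem one_sub_mul_one_sub_pos {θ x : ℝ} (hθ : θ ≤ 1) (hx0 : 0 < x) (hx1 : x < 1) :
    0 < 1 - θ * (1 - x) := by
  nlinarith

/-- Strict concavity in the form of a tangent line at `θ₀`: log y ≤ y - 1 is applied to each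
logarithm, strictly to log(θ/θ₀), whose coefficient is the number of outer edges. -/
theorem snapshotLik_lt {G : KGraph K} (hG : G.Nondegenerate) (hout : ∃ k, 0 < G.outerEdges k)
    {θ θ₀ : ℝ} (hθ : θ ∈ Set.Ioc (0 : ℝ) 1) (hθ₀ : θ₀ ∈ Set.Ioc (0 : ℝ) 1) (hne : θ ≠ θ₀) :
    G.snapshotLik θ < G.snapshotLik θ₀ + (θ - θ₀) / θ₀ * G.score θ₀ := by
  obtain ⟨h0, h1⟩ := hθ
  obtain ⟨h0', h1'⟩ := hθ₀
  have hlog : Real.log (θ / θ₀) < (θ - θ₀) / θ₀ := by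
    have := Real.log_lt_sub_one_of_pos (div_pos h0 h0') (by
      intro h; exact hne ((div_eq_one_iff_eq h0'.ne').1 h))
    rwa [sub_div, div_self h0'.ne']
  have hin : ∀ k, (G.innerEdges k : ℝ) * Real.log (G.edgeShare k *
        (G.edgeShare k + (1 - θ) * (1 - G.edgeShare k))) ≤
      G.innerEdges k * Real.log (G.edgeShare k *
        (G.edgeShare k + (1 - θ₀) * (1 - G.edgeShare k))) -
      (θ - θ₀) / θ₀ * (G.innerEdges k *
        (θ₀ * (1 - G.edgeShare k) / (1 - θ₀ * (1 - G.edgeShare k)))) := by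
    intro k
    rcases hG k with ⟨hk, -⟩ | ⟨hx0, hx1⟩
    · simp [hk]
    generalize G.edgeShare k = x at hx0 hx1
    have hy := one_sub_mul_one_sub_pos h1 hx0 hx1
    have hy' := one_sub_mul_one_sub_pos h1' hx0 hx1
    have e1 : x + (1 - θ) * (1 - x) = 1 - θ * (1 - x) := by ring
    have e2 : x + (1 - θ₀) * (1 - x) = 1 - θ₀ * (1 - x) := by ring
    rw [e1, e2, Real.log_mul hx0.ne' hy.ne', Real.log_mul hx0.ne' hy'.ne']
    have h2 : Real.log (1 - θ * (1 - x)) - Real.log (1 - θ₀ * (1 - x)) ≤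
        -((θ - θ₀) / θ₀ * (θ₀ * (1 - x) / (1 - θ₀ * (1 - x)))) := by
      rw [← Real.log_div hy.ne' hy'.ne']
      refine (Real.log_le_sub_one_of_pos (div_pos hy hy')).trans_eq ?_
      have := h0'.ne'
      generalize hY : 1 - θ₀ * (1 - x) = Y at hy'
      have := hy'.ne'
      field_simp
      rw [← hY]
      ring
    have h3 := mul_le_mul_of_nonneg_left h2 (Nat.cast_nonneg (G.innerEdges k) : (0 : ℝ) ≤ _)
    linarith
  have hou : ∀ k, (G.outerEdges k : ℝ) * Real.log (G.edgeShare k * θ * (1 - G.edgeShare k)) =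
      G.outerEdges k * Real.log (G.edgeShare k * θ₀ * (1 - G.edgeShare k)) +
      G.outerEdges k * Real.log (θ / θ₀) := by
    intro k
    rcases hG k with ⟨-, hk⟩ | ⟨hx0, hx1⟩
    · simp [hk]
    have hx1' : 0 < 1 - G.edgeShare k := by linarith
    rw [← mul_add, ← Real.log_mul (by positivity) (by positivity)]
    congr 2
    field_simp
  have hA : (∑ k, (G.outerEdges k : ℝ)) * Real.log (θ / θ₀) <
      (∑ k, (G.outerEdges k : ℝ)) * ((θ - θ₀) / θ₀) := by
    refine mul_lt_mul_of_pos_left hlog ?_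
    obtain ⟨k, hk⟩ := hout
    exact Finset.sum_pos' (fun k _ => Nat.cast_nonneg _) ⟨k, Finset.mem_univ _, by exact_mod_cast hk⟩
  have hin' := Finset.sum_le_sum fun k (_ : k ∈ Finset.univ) => hin k
  have hou' := Finset.sum_congr rfl fun k (_ : k ∈ Finset.univ) => hou k
  rw [Finset.sum_sub_distrib, ← Finset.mul_sum] at hin'
  rw [Finset.sum_add_distrib, ← Finset.sum_mul] at hou'
  simp only [snapshotLik, score, Finset.sum_sub_distrib]
  simp only [edgeShare] at hin' hou' ⊢
  rw [hou', mul_sub]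
  linarith

/-- The likelihood at the maximiser is at least that at `θ₀`, so the tangent line at `θ₀` must rise
towards the maximiser. -/
theorem IsSnapshotMaximizer.score_pos_of_gt {G : KGraph K} (hG : G.Nondegenerate)
    (hout : ∃ k, 0 < G.outerEdges k) {θ θ₀ : ℝ} (h : G.IsSnapshotMaximizer θ)
    (hθ₀ : θ₀ ∈ Set.Ioc (0 : ℝ) 1) (hlt : θ₀ < θ) : 0 < G.score θ₀ := by
  have h1 := snapshotLik_lt hG hout h.1 hθ₀ hlt.ne'
  have h2 := h.2 θ₀ hθ₀
  exact pos_of_mul_pos_right (by linarith) (div_nonneg (by linarith) hθ₀.1.le)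

theorem IsSnapshotMaximizer.score_neg_of_lt {G : KGraph K} (hG : G.Nondegenerate)
    (hout : ∃ k, 0 < G.outerEdges k) {θ θ₀ : ℝ} (h : G.IsSnapshotMaximizer θ)
    (hθ₀ : θ₀ ∈ Set.Ioc (0 : ℝ) 1) (hlt : θ < θ₀) : G.score θ₀ < 0 := by
  have h1 := snapshotLik_lt hG hout h.1 hθ₀ hlt.ne
  have h2 := h.2 θ₀ hθ₀
  exact neg_of_mul_pos_right (by linarith) (div_nonpos_of_nonpos_of_nonneg (by linarith) hθ₀.1.le)

theorem continuousOn_score {G : KGraph K} (hG : G.Nondegenerate) :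
    ContinuousOn G.score (Set.Icc 0 1) := by
  refine continuousOn_finsetSum _ fun k _ => ContinuousOn.sub continuousOn_const ?_
  rcases hG k with ⟨hk, -⟩ | ⟨hx0, hx1⟩
  · simp only [hk, Nat.cast_zero, zero_mul]
    exact continuousOn_const
  · refine continuousOn_const.mul (ContinuousOn.div (by fun_prop) (by fun_prop) fun θ hθ => ?_)
    exact (one_sub_mul_one_sub_pos hθ.2 hx0 hx1).ne'

/-- Unlike the likelihood, the score is continuous up to θ = 0, where it equals the number of outer
edges. Either it is still nonnegative at 1, and 1 is the maximiser, or it has a zero in (0, 1]; the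
tangent inequality there gives strict maximality. -/
theorem existsUnique_isSnapshotMaximizer {G : KGraph K} (hG : G.Nondegenerate)
    (hout : ∃ k, 0 < G.outerEdges k) : ∃! θ, G.IsSnapshotMaximizer θ := by
  suffices ∃ θ₀ ∈ Set.Ioc (0 : ℝ) 1, ∀ θ ∈ Set.Ioc (0 : ℝ) 1, θ ≠ θ₀ →
      G.snapshotLik θ < G.snapshotLik θ₀ by
    obtain ⟨θ₀, hθ₀, h⟩ := this
    refine ⟨θ₀, ⟨hθ₀, fun θ hθ => ?_⟩, fun θ hθ => ?_⟩
    · rcases eq_or_ne θ θ₀ with rfl | hne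
      · exact le_rfl
      · exact (h θ hθ hne).le
    · by_contra hne
      exact (h θ hθ.1 hne).not_ge (hθ.2 θ₀ hθ₀)
  rcases le_or_gt 0 (G.score 1) with h1 | h1
  · refine ⟨1, by simp, fun θ hθ hne => (snapshotLik_lt hG hout hθ (by simp) hne).trans_le ?_⟩
    have : (θ - 1) / 1 * G.score 1 ≤ 0 :=
      mul_nonpos_of_nonpos_of_nonneg (by linarith [hθ.2]) h1
    linarith
  · have h0 : 0 < G.score 0 := by
      obtain ⟨k, hk⟩ := hout
      simp only [score, zero_mul, zero_div, mul_zero, sub_zero]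
      exact Finset.sum_pos' (fun k _ => Nat.cast_nonneg _)
        ⟨k, Finset.mem_univ _, by exact_mod_cast hk⟩
    obtain ⟨θ₀, hθ₀, hs⟩ := intermediate_value_Icc' zero_le_one (continuousOn_score hG)
      ⟨h1.le, h0.le⟩
    have hθ₀' : θ₀ ∈ Set.Ioc (0 : ℝ) 1 := by
      refine ⟨lt_of_le_of_ne hθ₀.1 ?_, hθ₀.2⟩
      rintro rfl
      exact h0.ne' hs
    refine ⟨θ₀, hθ₀', fun θ hθ hne => ?_⟩
    have := snapshotLik_lt hG hout hθ hθ₀' hne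
    rwa [hs, mul_zero, add_zero] at this

/-- If the normalized scores converge to a function which is positive below `θs` and negative above
`θs`, then maximizers of the likelihood converge to `θs`. -/
theorem tendsto_of_isSnapshotMaximizer {g : ℕ → KGraph K} {H : ℝ → ℝ} {θs : ℝ}
    (hθs : θs ∈ Set.Ioc (0 : ℝ) 1) (hg : ∀ᶠ T in atTop, (g T).Nondegenerate)
    (hout : ∀ᶠ T in atTop, ∃ k, 0 < (g T).outerEdges k)
    (hscore : ∀ θ ∈ Set.Ioc (0 : ℝ) 1,
      Tendsto (fun T : ℕ => (g T).score θ / T) atTop (𝓝 (H θ)))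
    (hpos : ∀ θ ∈ Set.Ioc (0 : ℝ) 1, θ < θs → 0 < H θ)
    (hneg : ∀ θ ∈ Set.Ioc (0 : ℝ) 1, θs < θ → H θ < 0)
    {θt : ℕ → ℝ} (hθt : ∀ᶠ T in atTop, (g T).IsSnapshotMaximizer (θt T)) :
    Tendsto θt atTop (𝓝 θs) := by
  refine tendsto_order.2 ⟨fun l hl => ?_, fun u hu => ?_⟩
  -- The maximum with 0 keeps the test point in (0, 1] when `l` is negative.
  · obtain ⟨θ₀, h1, h2⟩ := exists_between (max_lt hl hθs.1)
    have hl₀ := (le_max_left _ _).trans_lt h1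
    have hθ₀ : θ₀ ∈ Set.Ioc (0 : ℝ) 1 := ⟨(le_max_right _ _).trans_lt h1, h2.le.trans hθs.2⟩
    filter_upwards [hg, hout, hθt, (hscore θ₀ hθ₀).eventually (lt_mem_nhds (hpos θ₀ hθ₀ h2)),
      eventually_gt_atTop 0] with T hT1 hT2 hT3 hT4 hT5
    by_contra! hc
    have h3 := hT3.score_neg_of_lt hT1 hT2 hθ₀ (hc.trans_lt hl₀)
    exact hT4.not_gt (div_neg_of_neg_of_pos h3 (by exact_mod_cast hT5))
  · rcases hθs.2.lt_or_eq with hs | rfl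
    · obtain ⟨θ₀, h1, h2⟩ := exists_between (lt_min hu hs)
      have hu₀ := h2.trans_le (min_le_left _ _)
      have hθ₀ : θ₀ ∈ Set.Ioc (0 : ℝ) 1 := ⟨hθs.1.trans h1, (h2.trans_le (min_le_right _ _)).le⟩
      filter_upwards [hg, hout, hθt, (hscore θ₀ hθ₀).eventually (gt_mem_nhds (hneg θ₀ hθ₀ h1)),
        eventually_gt_atTop 0] with T hT1 hT2 hT3 hT4 hT5
      by_contra! hc
      have h3 := hT3.score_pos_of_gt hT1 hT2 hθ₀ (hu₀.trans_le hc)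
      exact hT4.not_gt (div_pos h3 (by exact_mod_cast hT5))
    -- If `θs` is the endpoint 1, the constraint θ ≤ 1 already gives the upper bound.
    · filter_upwards [hθt] with T hT
      exact hT.1.2.trans_lt hu

/-! ### From the limits of the counts to the maximiser -/

theorem Regular.edges_eq_zero {p : Fin K → ℝ} {g : KGraph K} (h : Regular p g) {k : Fin K}
    (hk : ¬ 0 < p k) : g.innerEdges k = 0 ∧ g.outerEdges k = 0 := by
  have : ∀ i, g.grp i ≠ k := fun i hi => hk (hi ▸ h.grp_pos i)
  constructor
  · exact Multiset.countP_eq_zero.2 fun e _ he => this _ he.1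
  · exact Multiset.countP_eq_zero.2 fun e _ he => this _ he.1

theorem edgeShare_eq (g : KGraph K) (hg : 0 < g.totalDeg) (k : Fin K) :
    g.edgeShare k = g.share k * ((g.totalDeg : ℝ) / (2 * g.numEdges)) := by
  have : (g.totalDeg : ℝ) ≠ 0 := by exact_mod_cast hg.ne'
  rw [edgeShare, share, div_mul_div_cancel₀ this]

variable {p : Fin K → ℝ} {q θs : ℝ} {g : ℕ → KGraph K} {a : Fin K → ℝ}

/-- Behaviour of the likelihood along a path with the almost sure limits of the counts. -/
theorem snapshotMaximizer_of_limits (hp : ∀ k, 0 ≤ p k) (hp1 : ∑ k, p k = 1) (hplt : ∀ k, p k < 1)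
    (hq : q ∈ Set.Icc (0 : ℝ) 1) (hθs : θs ∈ Set.Ioc (0 : ℝ) 1)
    (hreg : ∀ T, Regular p (g T)) (hapos : ∀ k, 0 < p k → 0 < a k)
    (hshare : ∀ k, Tendsto (fun T => (g T).share k) atTop (𝓝 (a k)))
    (hratio : Tendsto (fun T => ((g T).totalDeg : ℝ) / (2 * (g T).numEdges)) atTop (𝓝 1))
    (hin : ∀ k, Tendsto (fun T : ℕ => ((g T).innerEdges k : ℝ) / T) atTop
        (𝓝 ((q * p k + (1 - q) * a k) * (1 - θs * (1 - a k)))))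
    (hout : ∀ k, Tendsto (fun T : ℕ => ((g T).outerEdges k : ℝ) / T) atTop
        (𝓝 ((q * p k + (1 - q) * a k) * (θs * (1 - a k))))) :
    (∀ᶠ T in atTop, ∃! θ, (g T).IsSnapshotMaximizer θ) ∧
      ∀ θt : ℕ → ℝ, (∀ᶠ T in atTop, (g T).IsSnapshotMaximizer (θt T)) →
        Tendsto θt atTop (𝓝 θs) := by
  -- Another group of positive probability has a positive limit share, which leaves less than 1 for
  -- group `k`.
  have ha1 : ∀ k, a k < 1 := by
    intro k
    obtain ⟨j, hjk, hj⟩ : ∃ j, j ≠ k ∧ 0 < p j := by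
      by_contra! hc
      have : ∑ j, p j = p k := Finset.sum_eq_single k
        (fun j _ hj => le_antisymm (hc j hj) (hp j)) (by simp)
      linarith [hplt k]
    have h1 : a j + a k ≤ 1 := by
      refine le_of_tendsto ((hshare j).add (hshare k)) (Eventually.of_forall fun T => ?_)
      rw [← sum_share ((hreg T).totalDeg_pos hp1), ← Finset.sum_pair hjk]
      exact Finset.sum_le_sum_of_subset_of_nonneg (Finset.subset_univ _)
        fun i _ _ => share_nonneg _ _
    linarith [hapos j hj]
  have ha0 : ∀ k, ¬ 0 < p k → a k = 0 := fun k hk =>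
    tendsto_nhds_unique (hshare k) (by simp only [(hreg _).share_eq_zero hk, tendsto_const_nhds])
  have hx : ∀ k, Tendsto (fun T => (g T).edgeShare k) atTop (𝓝 (a k)) := by
    intro k
    have := (hshare k).mul hratio
    rw [mul_one] at this
    exact this.congr fun T => ((g T).edgeShare_eq ((hreg T).totalDeg_pos hp1) k).symm
  -- This is the limiting frequency with which the asking node belongs to group `k`.
  have hπ : ∀ k, 0 < p k → 0 < q * p k + (1 - q) * a k := by
    intro k hk
    have := hapos k hk
    rcases hq.1.lt_or_eq with h | rfl
    · have : 0 ≤ (1 - q) * a k := mul_nonneg (by linarith [hq.2]) this.le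
      positivity
    · simpa using this
  obtain ⟨k₀, hk₀⟩ : ∃ k, 0 < p k := by
    by_contra! hc
    have := Finset.sum_nonpos fun k (_ : k ∈ Finset.univ) => hc k
    linarith
  have hnd : ∀ᶠ T in atTop, (g T).Nondegenerate := by
    refine eventually_all.2 fun k => ?_
    by_cases hk : 0 < p k
    · filter_upwards [(hx k).eventually (lt_mem_nhds (hapos k hk)),
        (hx k).eventually (gt_mem_nhds (ha1 k))] with T h1 h2 using Or.inr ⟨h1, h2⟩
    · exact Eventually.of_forall fun T => Or.inl ((hreg T).edges_eq_zero hk)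
  have hou : ∀ᶠ T in atTop, ∃ k, 0 < (g T).outerEdges k := by
    have h1 : 0 < (q * p k₀ + (1 - q) * a k₀) * (θs * (1 - a k₀)) :=
      mul_pos (hπ k₀ hk₀) (mul_pos hθs.1 (by linarith [ha1 k₀]))
    filter_upwards [(hout k₀).eventually (lt_mem_nhds h1)] with T hT
    refine ⟨k₀, Nat.pos_of_ne_zero fun h => ?_⟩
    simp [h] at hT
  refine ⟨?_, fun θt hθt => tendsto_of_isSnapshotMaximizer
    (H := fun θ => (θs - θ) *
      ∑ k, (q * p k + (1 - q) * a k) * (1 - a k) / (1 - θ * (1 - a k)))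
    hθs hnd hou (fun θ hθ => ?_) ?_ ?_ hθt⟩
  · filter_upwards [hnd, hou] with T h1 h2 using existsUnique_isSnapshotMaximizer h1 h2
  · simp only [score, Finset.sum_div, Finset.mul_sum]
    refine tendsto_finsetSum _ fun k _ => ?_
    by_cases hk : 0 < p k
    · have hy := one_sub_mul_one_sub_pos hθ.2 (hapos k hk) (ha1 k)
      have h1 : Tendsto (fun T => θ * (1 - (g T).edgeShare k) / (1 - θ * (1 - (g T).edgeShare k)))
          atTop (𝓝 (θ * (1 - a k) / (1 - θ * (1 - a k)))) :=
        (((hx k).const_sub 1).const_mul θ).div ((((hx k).const_sub 1).const_mul θ).const_sub 1)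
          hy.ne'
      have h2 := (hout k).sub ((hin k).mul h1)
      -- Over the common denominator, θs(1 - θ(1 - a)) - θ(1 - θs(1 - a)) = θs - θ, so every group
      -- changes sign at the same point `θs`.
      have h3 : (q * p k + (1 - q) * a k) * (θs * (1 - a k)) -
          (q * p k + (1 - q) * a k) * (1 - θs * (1 - a k)) *
            (θ * (1 - a k) / (1 - θ * (1 - a k))) =
          (θs - θ) * ((q * p k + (1 - q) * a k) * (1 - a k) / (1 - θ * (1 - a k))) := by
        generalize hY : 1 - θ * (1 - a k) = Y at hy
        have := hy.ne'
        field_simp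
        rw [← hY]
        ring
      rw [h3] at h2
      exact h2.congr fun T => by ring
    · have hpk : p k = 0 := le_antisymm (not_lt.1 hk) (hp k)
      simp [((hreg _).edges_eq_zero hk).1, ((hreg _).edges_eq_zero hk).2, ha0 k hk, hpk]
  all_goals
    intro θ hθ hlt
    have hsum : 0 < ∑ k, (q * p k + (1 - q) * a k) * (1 - a k) / (1 - θ * (1 - a k)) := by
      have hterm : ∀ k, 0 < p k →
          0 < (q * p k + (1 - q) * a k) * (1 - a k) / (1 - θ * (1 - a k)) := fun k hk =>
        div_pos (mul_pos (hπ k hk) (by linarith [ha1 k]))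
          (one_sub_mul_one_sub_pos hθ.2 (hapos k hk) (ha1 k))
      refine Finset.sum_pos' (fun k _ => ?_) ⟨k₀, Finset.mem_univ _, hterm k₀ hk₀⟩
      by_cases hk : 0 < p k
      · exact (hterm k hk).le
      · simp [ha0 k hk, le_antisymm (not_lt.1 hk) (hp k)]
  · exact mul_pos (by linarith) hsum
  · exact mul_neg_of_neg_of_pos (by linarith) hsum

theorem regular_of_deg_eq_one (hp : ∀ k, 0 ≤ p k) {G₀ : KGraph K} (hn₀ : 0 < G₀.n)
    (hdeg : ∀ i, G₀.deg i = 1) (hgrp : ∀ k, (G₀.groupSize k : ℝ) = p k * G₀.n) :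
    Regular p G₀ := by
  have hn : (0 : ℝ) < G₀.n := by exact_mod_cast hn₀
  refine ⟨fun i => (hp _).lt_of_ne fun h => ?_, fun k hk => ?_⟩
  · have h1 := hgrp (G₀.grp i)
    rw [← h, zero_mul, Nat.cast_eq_zero, groupSize, Finset.card_eq_zero] at h1
    have h2 : i ∈ Finset.univ.filter fun j => G₀.grp j = G₀.grp i := by simp
    rw [h1] at h2
    simp at h2
  · have h1 : (0 : ℝ) < G₀.groupSize k := by rw [hgrp k]; positivity
    have h2 : G₀.groupDeg k = G₀.groupSize k := by simp [groupDeg, groupSize, hdeg]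
    rw [h2]
    exact_mod_cast h1

end KGraph

/-! ### The theorem -/

open KGraph in
theorem theorem6 {Ω : Type*} [MeasurableSpace Ω] (P : Measure Ω) [IsProbabilityMeasure P]
    {K : ℕ} (p : Fin K → ℝ) (hp : ∀ k, 0 ≤ p k) (hp1 : ∑ k, p k = 1)
    (q : ℝ) (hq : q ∈ Set.Icc (0 : ℝ) 1)
    (γ α : ℝ) (hγ : γ ∈ Set.Ioc (0 : ℝ) 1) (hα : α ∈ Set.Ioc (0 : ℝ) 1)
    (G₀ : KGraph K) (hn₀ : 0 < G₀.n) (hdeg : ∀ i, G₀.deg i = 1)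
    (hgrp : ∀ k, (G₀.groupSize k : ℝ) = p k * G₀.n)
    (G : ℕ → Ω → KGraph K) (hG : IsKPA P p q γ α G₀ G) :
    ∀ᵐ ω ∂P,
      (∀ k, Tendsto (fun T => ((G T ω).groupSize k : ℝ) / (G T ω).n) atTop (𝓝 (p k))) ∧
      Tendsto (fun T => ((G T ω).n : ℝ) / (G T ω).numEdges) atTop (𝓝 q) ∧
      ((∀ k, p k < 1) →
        (∀ᶠ T in atTop, ∃! θ, (G T ω).IsSnapshotMaximizer θ) ∧
        ∀ θt : ℕ → ℝ, (∀ᶠ T in atTop, (G T ω).IsSnapshotMaximizer (θt T)) →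
          Tendsto θt atTop (𝓝 (γ / (γ + α * (1 - γ))))) := by
  have hG₀ := regular_of_deg_eq_one hp hn₀ hdeg hgrp
  have hθs : γ / (γ + α * (1 - γ)) ∈ Set.Ioc (0 : ℝ) 1 := by
    obtain ⟨hγ0, hγ1⟩ := hγ
    have h0 : 0 ≤ α * (1 - γ) := mul_nonneg hα.1.le (by linarith)
    exact ⟨by positivity, div_le_one_of_le₀ (by linarith) (by linarith)⟩
  have hconst : ∀ᵐ ω ∂P, q = 0 →
      ∀ t, (G t ω).n = G₀.n ∧ ∀ k, (G t ω).groupSize k = G₀.groupSize k := by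
    by_cases h : q = 0
    · subst h
      filter_upwards [hG.ae_groupSize_eq_of_q_eq_zero hp hp1 hγ hα hG₀] with ω h _ using h
    · exact ae_of_all _ fun ω h0 => absurd h0 h
  filter_upwards [hG.ae_path hp hp1 hγ hα hG₀, hG.ae_totalDeg_numEdges hp hp1 hγ hα hG₀,
    hG.ae_exists_limits hp hp1 hγ hα hq hG₀, hconst]
    with ω hpath hcount ⟨a, hapos, hshare, hn, hV, hin, hout⟩ hω
  refine ⟨fun k => ?_, ?_, fun hplt => ?_⟩
  -- For q = 0 the limits of `groupSize / T` and `n / T` are both 0 and their quotient says nothing;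
  -- but then the node counts never change and the initial proportions are exact.
  · by_cases h : q = 0
    · have h1 : ∀ T, ((G T ω).groupSize k : ℝ) / (G T ω).n = p k := by
        intro T
        rw [(hω h T).1, (hω h T).2 k, hgrp k, mul_div_cancel_right₀]
        exact_mod_cast hn₀.ne'
      simp only [h1, tendsto_const_nhds]
    · have h1 := (hV k).div hn h
      rw [mul_div_cancel_left₀ _ h] at h1
      refine h1.congr' ?_
      filter_upwards [eventually_ne_atTop 0] with T hT
      exact div_div_div_cancel_right₀ (by exact_mod_cast hT) _ _
  · have h1 := hn.mul (tendsto_add_mul_div_add_mul_atTop_nhds (0 : ℝ) G₀.numEdges 1 one_ne_zero)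
    rw [div_one, mul_one] at h1
    refine h1.congr' ?_
    filter_upwards [eventually_ne_atTop 0] with T hT
    have hT' : (T : ℝ) ≠ 0 := by exact_mod_cast hT
    rw [(hcount T).2]
    push_cast
    rw [zero_add, one_mul, div_mul_div_cancel₀ hT']
  · refine snapshotMaximizer_of_limits hp hp1 hplt hq hθs (fun T => (hpath.2 T).1) hapos hshare ?_
      hin hout
    -- By the convention on the initial degrees, the total degree need not be twice the number of
    -- edges; the ratio tends to 1 because both grow by 2 at every step.
    have h1 := tendsto_add_mul_div_add_mul_atTop_nhds (G₀.totalDeg : ℝ) (2 * G₀.numEdges) 2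
      two_ne_zero
    rw [div_self two_ne_zero] at h1
    refine h1.congr fun T => ?_
    rw [(hcount T).1, (hcount T).2]
    push_cast
    ring_nf

end
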